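/- **Setting.** Let $M=(\mathcal X,\mathcal A,P,R,H,d_1)$ be an episodic MDP with countable $\mathcal X,\mathcal A$, horizon $H$, initial state law $d_1$, transitions $P_h(x,a)\in\Delta(\mathcal X)$ and rewards $R_h(x,a)\in\Delta([0,1])$. For a policy $\pi$ let $J(\pi)=\mathbb E^\pi[\sum_h r_h]$ and $d^\pi_h(x,a)=\mathbb P^\pi[x_h=x,a_h=a]$. Let $\mathcal F$ be a finite class of functions $f=(f_h)_{h=1}^H$, $f_h:\mathcal X\times\mathcal A\to[0,1]$, with the convention $f_{H+1}=0$. Let $\pi_f$ be a greedy policy of $f$, i.e. $\pi_{f,h}(x)\in\arg\max_a f_h(x,a)$ with a fixed tie-breaking rule (the maxima are assumed to be attained for $f\in\mathcal F$), and let $\Pi=\{\pi_f: f\in\mathcal F\}$. Let $\pi^\star\in\Pi$ be a deterministic policy that maximizes the value at all states and layers among all policies, and let $Q^\star=Q^{\pi^\star}$. Let $\mathcal W$ be a finite class of functions $w=(w_h)_{h=1}^H$, $w_h:\mathcal X\times\mathcal A\to[0,\infty]$, and put $\mathcal W_h=\{w_h: w\in\mathcal W\}$. In density ratios, $c/0=\infty$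 for $c>0$ and $0/0=1$. For $w\ge 0$ let $\mathrm{clip}_c[w]=\min\{w,c\}$, and let $\mathrm{clip}_c[-w]=-\mathrm{clip}_c[w]$. For $w\in\mathcal W$ let $w^{(h)}$ agree with $w$ in layer $h$ and vanish in the other layers, let $\mathcal W^{(h)}=\{w^{(h)}:w\in\mathcal W\}$, and let $$\overline{\mathcal W}=\mathcal W\cup(-\mathcal W)\cup\bigcup_{h}\bigl(\mathcal W^{(h)}\cup(-\mathcal W^{(h)})\bigr).$$ **Data.** Let $n\ge1$. The dataset is $\mathcal D=\{\mathcal D_h\}_{h=1}^H$, $\mathcal D_h=\{(x_h^{(i)},a_h^{(i)},r_h^{(i)},x_{h+1}^{(i)})\}_{i=1}^n$, where $(x_h^{(i)},a_h^{(i)})\sim\mu^{(i)}_h$, $r_h^{(i)}\sim R_h(x_h^{(i)},a_h^{(i)})$, $x_{h+1}^{(i)}\sim P_h(x_h^{(i)},a_h^{(i)})$. The data distributions $\mu^{(1)},\dots,\mu^{(n)}$ may be chosen adaptively: $\mu^{(i+1)}$ may depend on the samples of rounds $1,\dots,i$, and the sampling laws are then understood conditionally on the past. Let $\mu^{(1:n)}_h=\frac1n\sum_{i=1}^n\mu^{(i)}_h$.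 **Algorithm.** For $\gamma>0$, MABO.CR with parameters $\mathcal F,\overline{\mathcal W},\gamma$ outputs $\hat\pi=\pi_{\hat f}$ for some $$\hat f\in\arg\min_{f\in\mathcal F}\ \max_{w\in\overline{\mathcal W}}\ \sum_{h=1}^H\Bigl(\bigl|\widehat{\mathbb E}_{\mathcal D_h}\bigl[\check w_h(x_h,a_h)\,[\widehat\Delta_hf](x_h,a_h,r_h,x_{h+1})\bigr]\bigr|-\tfrac{8}{\gamma n}\,\widehat{\mathbb E}_{\mathcal D_h}\bigl[\check w_h(x_h,a_h)^2\bigr]\Bigr),$$ where $\check w_h=\mathrm{clip}_{\gamma n}[w_h]$, $[\widehat\Delta_hf](x,a,r,x')=f_h(x,a)-r-\max_{a'}f_{h+1}(x',a')$, and $\widehat{\mathbb E}_{\mathcal D_h}$ is the average over the $n$ samples in $\mathcal D_h$. **CC-boundedness.** For a policy $\pi$ and a data distribution $\mu$ let $\mathsf{CC}_h(\pi,\mu,c)=\mathbb E_{(x,a)\sim d^\pi_h}\bigl[\mathrm{clip}_c[d^\pi_h/\mu_h](x,a)\bigr]$. An offline algorithm is CC-bounded at scale $\gamma$ under a condition $\mathsf{Cond}$,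 with scalars $\mathfrak a_\gamma,\mathfrak b_\gamma$ (which may depend on the failure probability $\delta$), if for all $n\ge1$ and all data distributions $\mu^{(1)},\dots,\mu^{(n)}$ such that $\mathsf{Cond}(\mu^{(1:n)},M)$ holds (almost surely), it outputs $p\in\Delta(\Pi)$ such that with probability at least $1-\delta$ $$\mathbb E_{\hat\pi\sim p}[J(\pi^\star)-J(\hat\pi)]\le\sum_{h=1}^H\frac{\mathfrak a_\gamma}{n}\Bigl(\mathsf{CC}_h(\pi^\star,\mu^{(1:n)},\gamma n)+\mathbb E_{\hat\pi\sim p}\bigl[\mathsf{CC}_h(\hat\pi,\mu^{(1:n)},\gamma n)\bigr]\Bigr)+\mathfrak b_\gamma .$$ **Theorem (MABO.CR is CC-bounded).** For every $\gamma>0$ and $\delta\in(0,1)$, MABO.CR with parameters $\mathcal F$, $\overline{\mathcal W}$ and $\gamma$ is CC-bounded at scale $\gamma$ under the condition that $Q^\star\in\mathcal F$ and that $d^\pi_h/\mu^{(1:n)}_h\in\mathcal W_h$ for all $\pi\in\Pi$ and $h\in[H]$, with $$\mathfrak a_\gamma=\frac{40}{\gamma},\qquad \mathfrak b_\gamma=56\,H^2\gamma\,\log\!\Bigl(\frac{24\,|\mathcal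 F|\,|\mathcal W|\,H^2}{\delta}\Bigr).$$ -/

import Mathlib

open scoped ENNReal
open MeasureTheory

universe uΩ

noncomputable section

/-- A finite-horizon Markov decision process with layers `0, …, H - 1`, reward laws supported
on `[0, 1]` and initial state law `init`. -/
structure EpisodicMDP (X A : Type*) (H : ℕ) where
  init : PMF X
  P : Fin H → X → A → PMF X
  R : Fin H → X → A → Measure ℝ
  R_prob : ∀ h x a, IsProbabilityMeasure (R h x a)
  R_mem : ∀ h x a, ∀ᵐ r ∂(R h x a), r ∈ Set.Icc (0 : ℝ) 1

/-- Randomized (Markov) policies. -/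
abbrev RandPolicy (X A : Type*) (H : ℕ) := Fin H → X → PMF A

/-- Deterministic (Markov) policies. -/
abbrev DetPolicy (X A : Type*) (H : ℕ) := Fin H → X → A

/-- A deterministic policy as a randomized one. -/
def DetPolicy.toRand {X A : Type*} {H : ℕ} (π : DetPolicy X A H) : RandPolicy X A H :=
  fun h x => PMF.pure (π h x)

/-- A data distribution: one law on state-action pairs for each layer. -/
abbrev DataDist (X A : Type*) (H : ℕ) := Fin H → PMF (X × A)

/-- One sample `(x, a, r, x')` of a layer. -/
abbrev Sample (X A : Type*) := X × A × ℝ × X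

/-- A dataset with `n` samples in each of the `H` layers. -/
abbrev Dataset (X A : Type*) (H n : ℕ) := Fin n → Fin H → Sample X A

namespace EpisodicMDP

def meanReward {X A : Type*} {H : ℕ} (M : EpisodicMDP X A H) (h : Fin H) (x : X) (a : A) : ℝ :=
  ∫ r, r ∂(M.R h x a)

/-- `V^π_i(x)`, the expected reward collected by `π` in the layers `i, …, H - 1` from the state
`x` in layer `i`; it is `0` after the last layer. -/
def V {X A : Type*} {H : ℕ} (M : EpisodicMDP X A H) (π : RandPolicy X A H) (i : ℕ) (x : X) : ℝ :=
  if hi : i < H then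
    ∑' a, (π ⟨i, hi⟩ x a).toReal *
      (M.meanReward ⟨i, hi⟩ x a +
        ∑' x', (M.P ⟨i, hi⟩ x a x').toReal * M.V π (i + 1) x')
  else 0
termination_by H - i

/-- `Q^π_h(x, a)`. -/
def Q {X A : Type*} {H : ℕ} (M : EpisodicMDP X A H) (π : RandPolicy X A H)
    (h : Fin H) (x : X) (a : A) : ℝ :=
  M.meanReward h x a + ∑' x', (M.P h x a x').toReal * M.V π ((h : ℕ) + 1) x'

/-- `J(π)`, the expected total reward. -/
def J {X A : Type*} {H : ℕ} (M : EpisodicMDP X A H) (π : RandPolicy X A H) : ℝ :=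
  ∑' x, (M.init x).toReal * M.V π 0 x

/-- The law of the state in layer `i` under `π`. -/
def stateLaw {X A : Type*} {H : ℕ} (M : EpisodicMDP X A H) (π : RandPolicy X A H) : ℕ → PMF X
  | 0 => M.init
  | i + 1 =>
    if hi : i < H then
      (M.stateLaw π i).bind fun x => (π ⟨i, hi⟩ x).bind fun a => M.P ⟨i, hi⟩ x a
    else M.stateLaw π i

/-- The occupancy measure `d^π_h`, the law of the state-action pair in layer `h` under `π`. -/
def occ {X A : Type*} {H : ℕ} (M : EpisodicMDP X A H) (π : RandPolicy X A H) (h : Fin H) :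
    PMF (X × A) :=
  (M.stateLaw π h).bind fun x => (π h x).map fun a => (x, a)

/-- A deterministic policy that maximizes the value at all states, in all layers, among all
randomized policies. -/
def IsOptimal {X A : Type*} {H : ℕ} (M : EpisodicMDP X A H) (πstar : DetPolicy X A H) : Prop :=
  ∀ (π : RandPolicy X A H) (i : ℕ) (x : X), M.V π i x ≤ M.V πstar.toRand i x

/-- The law of a sample `(x, a, r, x')` of layer `h`:
`(x, a) ∼ ν`, `r ∼ R_h(x, a)`, `x' ∼ P_h(x, a)`. -/
def sampleLaw {X A : Type*} {H : ℕ} [MeasurableSpace X] [MeasurableSpace A]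
    (M : EpisodicMDP X A H) (h : Fin H) (ν : PMF (X × A)) : Measure (Sample X A) :=
  Measure.sum fun p : X × A =>
    ν p • ((M.R h p.1 p.2).prod (M.P h p.1 p.2).toMeasure).map
      fun q : ℝ × X => ((p.1, p.2, q.1, q.2) : Sample X A)

/-- `D` consists of `H · n` samples from the adaptively chosen data distributions
`μ 0, …, μ (n - 1)`: the choice `μ i` is determined by the information `ℱ i` available before
round `i` (which contains the samples of the earlier rounds), and given `ℱ i` the sample of
layer `h` in round `i` has the law `sampleLaw h (μ i h)`. The joint law of the samples of one
round in different layers is arbitrary. -/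
structure IsAdaptiveSample {X A : Type*} {H : ℕ} [MeasurableSpace X] [MeasurableSpace A]
    (M : EpisodicMDP X A H) {Ω : Type uΩ} [mΩ : MeasurableSpace Ω] (ℙ : Measure Ω)
    (ℱ : Filtration ℕ mΩ) {n : ℕ} (μ : Fin n → Ω → DataDist X A H)
    (D : Ω → Dataset X A H n) : Prop where
  predictable : ∀ (i : Fin n) (h : Fin H) (p : X × A),
    Measurable[ℱ (i : ℕ)] fun ω => μ i ω h p
  adapted : ∀ (i : Fin n) (h : Fin H), Measurable[ℱ ((i : ℕ) + 1)] fun ω => D ω i h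
  condLaw : ∀ (i : Fin n) (h : Fin H) (E : Set Ω), MeasurableSet[ℱ (i : ℕ)] E →
    ∀ S : Set (Sample X A), MeasurableSet S →
      ℙ (E ∩ {ω | D ω i h ∈ S}) = ∫⁻ ω in E, M.sampleLaw h (μ i ω h) S ∂ℙ

end EpisodicMDP

/-- The mixture distribution `μ^{(1:n)}_h = (1/n) ∑ᵢ μ^{(i)}_h`. -/
def mixture {X A : Type*} {H n : ℕ} [NeZero n] (μ : Fin n → DataDist X A H) : DataDist X A H :=
  fun h => (PMF.uniformOfFintype (Fin n)).bind fun i => μ i h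

/-- The density ratio of two laws, with values in `[0, ∞]`, where `c / 0 = ∞` for `c > 0` and
`0 / 0 = 1`. -/
def densityRatio {X A : Type*} (d ν : PMF (X × A)) (x : X) (a : A) : ℝ≥0∞ :=
  if ν (x, a) = 0 then (if d (x, a) = 0 then 1 else ∞) else d (x, a) / ν (x, a)

/-- Clipping at scale `c`. On nonnegative weights this is `min w c`; on negative ones it is the
odd extension, so that `-w` is clipped to minus the clipped `w`. -/
def clip (c : ℝ) (w : EReal) : ℝ := (max (-(c : EReal)) (min w (c : EReal))).toReal

/-- The clipped concentrability coefficient of `π` relative to `ν` at scale `c` in layer `h`, the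
`L₁(d^π_h)`-norm of the clipped density ratio. -/
def clippedConc {X A : Type*} {H : ℕ} (M : EpisodicMDP X A H) (h : Fin H)
    (π : RandPolicy X A H) (ν : DataDist X A H) (c : ℝ) : ℝ :=
  ∑' p : X × A, (M.occ π h p).toReal *
    |clip c ((densityRatio (M.occ π h) (ν h) p.1 p.2 : ℝ≥0∞) : EReal)|

/-- Expectation of `g` under a discrete law on deterministic policies. -/
def policyExp {X A : Type*} {H : ℕ} (p : PMF (DetPolicy X A H)) (g : DetPolicy X A H → ℝ) : ℝ :=
  ∑' π, (p π).toReal * g π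

/-- An offline RL algorithm maps a dataset to a distribution over policies. -/
abbrev OfflineAlg (X A : Type*) (H : ℕ) :=
  (n : ℕ) → Dataset X A H n → PMF (DetPolicy X A H)

/-- The algorithm is CC-bounded at scale `γ` under the condition `Cond` on the mixture
distribution, with scalars `𝔞` and `𝔟` and failure probability `δ`, for the policy class `Pol`
and the optimal policy `πstar` of `M`. (The bound on the measure of the failure event is a bound
on its outer measure, so no measurability of the algorithm is needed.) -/
def IsCCBounded {X A : Type*} {H : ℕ} [MeasurableSpace X] [MeasurableSpace A]
    (M : EpisodicMDP X A H) (Pol : Set (DetPolicy X A H)) (πstar : DetPolicy X A H)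
    (algo : OfflineAlg X A H) (γ : ℝ) (Cond : DataDist X A H → Prop) (𝔞 𝔟 δ : ℝ) : Prop :=
  ∀ (n : ℕ) [NeZero n],
    (∀ D : Dataset X A H n, (algo n D).support ⊆ Pol) ∧
    ∀ (Ω : Type uΩ) [mΩ : MeasurableSpace Ω] (ℙ : Measure Ω) [IsProbabilityMeasure ℙ]
      (ℱ : Filtration ℕ mΩ) (μ : Fin n → Ω → DataDist X A H) (D : Ω → Dataset X A H n),
      M.IsAdaptiveSample ℙ ℱ μ D →
      (∀ᵐ ω ∂ℙ, Cond (mixture fun i => μ i ω)) →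
      ℙ {ω | ¬ (policyExp (algo n (D ω)) (fun π => M.J πstar.toRand - M.J π.toRand) ≤
          (∑ h : Fin H, 𝔞 / n *
            (clippedConc M h πstar.toRand (mixture fun i => μ i ω) (γ * n) +
              policyExp (algo n (D ω)) fun π =>
                clippedConc M h π.toRand (mixture fun i => μ i ω) (γ * n))) + 𝔟)}
        ≤ ENNReal.ofReal δ

/-- `max_{a'} f_{h+1}(x, a')`, where `f_{H+1} = 0`. -/
def nextMax {X A : Type*} {H : ℕ} (f : Fin H → X → A → ℝ) (h : Fin H) (x : X) : ℝ :=
  if hh : (h : ℕ) + 1 < H then ⨆ a', f ⟨(h : ℕ) + 1, hh⟩ x a' else 0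

/-- `[Δ̂_h f](x, a, r, x') = f_h(x, a) - r - max_{a'} f_{h+1}(x', a')`. -/
def tdError {X A : Type*} {H : ℕ} (f : Fin H → X → A → ℝ) (h : Fin H) (z : Sample X A) : ℝ :=
  f h z.1 z.2.1 - z.2.2.1 - nextMax f h z.2.2.2

/-- The empirical expectation over the samples of layer `h`. -/
def empExp {X A : Type*} {H n : ℕ} (D : Dataset X A H n) (h : Fin H) (g : Sample X A → ℝ) : ℝ :=
  (1 / (n : ℝ)) * ∑ i : Fin n, g (D i h)

/-- The clipped and regularized objective at `(f, w)`, with clipping at `γ n` and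
regularization parameter `8 / (γ n)`. -/
def maboObjective {X A : Type*} {H n : ℕ} (γ : ℝ) (D : Dataset X A H n)
    (f : Fin H → X → A → ℝ) (w : Fin H → X → A → EReal) : ℝ :=
  ∑ h : Fin H,
    (|empExp D h fun z => clip (γ * n) (w h z.1 z.2.1) * tdError f h z| -
      8 / (γ * n) * empExp D h fun z => clip (γ * n) (w h z.1 z.2.1) ^ 2)

/-- `f` minimizes over `F` the maximum of the objective over the (finite) class `W`. -/
def IsMaboMinimizer {X A : Type*} {H n : ℕ} (F : Finset (Fin H → X → A → ℝ))
    (W : Set (Fin H → X → A → EReal)) (γ : ℝ) (D : Dataset X A H n)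
    (f : Fin H → X → A → ℝ) : Prop :=
  f ∈ F ∧ ∀ f' ∈ F, sSup (maboObjective γ D f '' W) ≤ sSup (maboObjective γ D f' '' W)

/-- The algorithm is MABO.CR with parameters `F`, `W`, `γ`: on every dataset it outputs the greedy
policy of some minimizer. -/
def IsMaboCR {X A : Type*} {H : ℕ} (F : Finset (Fin H → X → A → ℝ))
    (W : Set (Fin H → X → A → EReal)) (γ : ℝ)
    (greedy : (Fin H → X → A → ℝ) → DetPolicy X A H) (algo : OfflineAlg X A H) : Prop :=
  ∀ (n : ℕ) [NeZero n] (D : Dataset X A H n),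
    ∃ f, IsMaboMinimizer F W γ D f ∧ algo n D = PMF.pure (greedy f)

/-- The weight function `w^{(h)}`, equal to `w` in layer `h` and to `0` in the other layers. -/
def restrictLayer {X A : Type*} {H : ℕ} (h : Fin H) (w : Fin H → X → A → EReal) :
    Fin H → X → A → EReal :=
  fun h' x a => if h = h' then w h x a else 0

/-- `W` as a set of extended-real valued functions. -/
def signedClass {X A : Type*} {H : ℕ} (W : Finset (Fin H → X → A → ℝ≥0∞)) :
    Set (Fin H → X → A → EReal) :=
  (fun w h x a => ((w h x a : ℝ≥0∞) : EReal)) '' (W : Set (Fin H → X → A → ℝ≥0∞))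

/-- Pointwise negation of a class. -/
def negClass {X A : Type*} {H : ℕ} (S : Set (Fin H → X → A → EReal)) :
    Set (Fin H → X → A → EReal) :=
  (fun w h x a => -(w h x a)) '' S

/-- The augmented class `W ∪ (-W) ∪ ⋃ₕ (W^{(h)} ∪ (-W^{(h)}))`. -/
def augmentedClass {X A : Type*} {H : ℕ} (W : Finset (Fin H → X → A → ℝ≥0∞)) :
    Set (Fin H → X → A → EReal) :=
  signedClass W ∪ negClass (signedClass W) ∪
    ⋃ h : Fin H, (restrictLayer h '' signedClass W ∪ negClass (restrictLayer h '' signedClass W))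

/-- The policy class induced by `F`. -/
def inducedPolicies {X A : Type*} {H : ℕ} (F : Finset (Fin H → X → A → ℝ))
    (greedy : (Fin H → X → A → ℝ) → DetPolicy X A H) : Set (DetPolicy X A H) :=
  {π | ∃ f ∈ F, π = greedy f}

/-- The condition on the data distribution `ν` (and `M`): `Q⋆ ∈ F`, where `Q⋆` is the value
function of the optimal policy, and `d^π_h / ν_h ∈ W_h` for all `π ∈ Pol` and all `h`. -/
def MaboCond {X A : Type*} {H : ℕ} (M : EpisodicMDP X A H) (πstar : DetPolicy X A H)
    (F : Finset (Fin H → X → A → ℝ)) (W : Finset (Fin H → X → A → ℝ≥0∞))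
    (Pol : Set (DetPolicy X A H)) (ν : DataDist X A H) : Prop :=
  M.Q πstar.toRand ∈ F ∧
    ∀ π ∈ Pol, ∀ h : Fin H, ∃ w ∈ W, w h = densityRatio (M.occ π.toRand h) (ν h)

end

/-! Put c = γn, and for a policy π in the class let v be the density ratio of d^π_h to the mixture,
clipped at c. Telescoping max_a f along trajectories bounds J(π⋆) - J(π_f) by Bellman errors of f
under the occupancies of π_f and π⋆ (`J_sub_J_greedy_le`). Both policies lie in Π, so it suffices to
control the error of the minimizer under each d^π_h.

Replacing d^π_h by v times the mixture costs at most (2/c)·CC, because mass is lost only where the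
ratio is clipped (`abs_pmfExp_sub_clip_le`). The second moment of v under the mixture is again at
most CC (`pmfExp_clip_sq_le`), so a variance-type error of order E[v²]/c is affordable.

The concentration step (`measure_le_exp_neg`, `measure_not_deviationLE_le`) is an exponential
supermartingale argument, valid for adaptive data, applied to the weighted TD error plus a multiple
t/c of v². Thus the empirical second moment is controlled together with the linear term. With t = -8
the regularizer absorbs the fluctuations of Q⋆, whose Bellman error is zero, so its objective is at
most Hε for every weight. With t = 8 a small objective of the minimizer implies a small weighted
Bellman error in population. Single-layer weights in the augmented class turn the bound on the
objective, a sum over layers, into one for each layer. -/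

/-! ### Expectations of bounded functions under discrete laws -/

/-- The expectation of a real function under a discrete law. -/
noncomputable def pmfExp {α : Type*} (p : PMF α) (g : α → ℝ) : ℝ := ∑' x, (p x).toReal * g x

theorem PMF.summable_toReal_mul {α : Type*} (p : PMF α) {g : α → ℝ} {C : ℝ}
    (hg : ∀ x, |g x| ≤ C) : Summable fun x => (p x).toReal * g x := by
  refine Summable.of_norm_bounded (g := fun x => (p x).toReal * C)
    ((ENNReal.summable_toReal p.tsum_coe_ne_top).mul_right C) fun x => ?_
  rw [norm_mul, Real.norm_eq_abs, Real.norm_eq_abs, abs_of_nonneg ENNReal.toReal_nonneg]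
  exact mul_le_mul_of_nonneg_left (hg x) ENNReal.toReal_nonneg

theorem PMF.tsum_toReal {α : Type*} (p : PMF α) : ∑' x, (p x).toReal = 1 := by
  rw [← ENNReal.tsum_toReal_eq p.apply_ne_top, p.tsum_coe, ENNReal.toReal_one]

theorem pmfExp_const {α : Type*} (p : PMF α) (c : ℝ) : pmfExp p (fun _ => c) = c := by
  rw [pmfExp, tsum_mul_right, p.tsum_toReal, one_mul]

theorem pmfExp_add {α : Type*} (p : PMF α) {f g : α → ℝ} {C D : ℝ}
    (hf : ∀ x, |f x| ≤ C) (hg : ∀ x, |g x| ≤ D) :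
    pmfExp p (fun x => f x + g x) = pmfExp p f + pmfExp p g := by
  simp only [pmfExp, mul_add]
  exact (p.summable_toReal_mul hf).tsum_add (p.summable_toReal_mul hg)

theorem pmfExp_sub {α : Type*} (p : PMF α) {f g : α → ℝ} {C D : ℝ}
    (hf : ∀ x, |f x| ≤ C) (hg : ∀ x, |g x| ≤ D) :
    pmfExp p (fun x => f x - g x) = pmfExp p f - pmfExp p g := by
  simp only [pmfExp, mul_sub]
  exact (p.summable_toReal_mul hf).tsum_sub (p.summable_toReal_mul hg)

theorem pmfExp_const_mul {α : Type*} (p : PMF α) (c : ℝ) (g : α → ℝ) :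
    pmfExp p (fun x => c * g x) = c * pmfExp p g := by
  simp only [pmfExp, mul_left_comm _ c]
  exact tsum_mul_left

theorem pmfExp_mono {α : Type*} (p : PMF α) {f g : α → ℝ} {C D : ℝ}
    (hf : ∀ x, |f x| ≤ C) (hg : ∀ x, |g x| ≤ D) (h : ∀ x, f x ≤ g x) :
    pmfExp p f ≤ pmfExp p g :=
  (p.summable_toReal_mul hf).tsum_le_tsum
    (fun x => mul_le_mul_of_nonneg_left (h x) ENNReal.toReal_nonneg) (p.summable_toReal_mul hg)

theorem pmfExp_nonneg {α : Type*} (p : PMF α) {g : α → ℝ} (hg : ∀ x, 0 ≤ g x) :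
    0 ≤ pmfExp p g :=
  tsum_nonneg fun x => mul_nonneg ENNReal.toReal_nonneg (hg x)

theorem abs_pmfExp_le {α : Type*} (p : PMF α) {g : α → ℝ} {C : ℝ} (hg : ∀ x, |g x| ≤ C) :
    |pmfExp p g| ≤ C := by
  have hC : ∀ c : ℝ, ∀ x : α, |(fun _ : α => c) x| ≤ |c| := fun c x => le_rfl
  refine abs_le.2 ⟨?_, ?_⟩
  · rw [← pmfExp_const p (-C)]
    exact pmfExp_mono p (hC _) hg fun x => (abs_le.1 (hg x)).1
  · rw [← pmfExp_const p C]
    exact pmfExp_mono p hg (hC _) fun x => (abs_le.1 (hg x)).2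

theorem pmfExp_pure {α : Type*} (x : α) (g : α → ℝ) : pmfExp (PMF.pure x) g = g x := by
  rw [pmfExp, tsum_eq_single x]
  · simp
  · intro y hy
    simp [PMF.pure_apply, hy]

theorem ofReal_pmfExp {α : Type*} (p : PMF α) {g : α → ℝ} {C : ℝ}
    (hg : ∀ x, |g x| ≤ C) (h0 : ∀ x, 0 ≤ g x) :
    ENNReal.ofReal (pmfExp p g) = ∑' x, p x * ENNReal.ofReal (g x) := by
  rw [pmfExp, ENNReal.ofReal_tsum_of_nonneg
    (fun x => mul_nonneg ENNReal.toReal_nonneg (h0 x)) (p.summable_toReal_mul hg)]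
  refine tsum_congr fun x => ?_
  rw [ENNReal.ofReal_mul ENNReal.toReal_nonneg, ENNReal.ofReal_toReal (p.apply_ne_top x)]

theorem pmfExp_bind {α β : Type*} (p : PMF α) (k : α → PMF β) {g : β → ℝ} {C : ℝ}
    (hg : ∀ x, |g x| ≤ C) :
    pmfExp (p.bind k) g = pmfExp p fun x => pmfExp (k x) g := by
  have key : ∀ {f : β → ℝ} {D : ℝ}, (∀ x, |f x| ≤ D) → (∀ x, 0 ≤ f x) →
      pmfExp (p.bind k) f = pmfExp p fun x => pmfExp (k x) f := by
    intro f D hf h0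
    rw [← ENNReal.ofReal_eq_ofReal_iff (pmfExp_nonneg _ h0)
      (pmfExp_nonneg _ fun x => pmfExp_nonneg _ h0), ofReal_pmfExp _ hf h0,
      ofReal_pmfExp _ (fun x => abs_pmfExp_le (k x) hf) fun x => pmfExp_nonneg _ h0]
    simp only [ofReal_pmfExp _ hf h0, PMF.bind_apply, ← ENNReal.tsum_mul_right,
      ← ENNReal.tsum_mul_left, mul_assoc]
    exact ENNReal.tsum_comm
  -- Tonelli handles nonnegative integrands; a bounded one is shifted by its bound and the constant
  -- is cancelled afterwards.
  have h1 : ∀ x, |g x + C| ≤ C + |C| := fun x =>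
    (abs_add_le _ _).trans (add_le_add_left (hg x) _)
  have h2 := key h1 fun x => by linarith [(abs_le.1 (hg x)).1]
  simp only [pmfExp_add _ hg (g := fun _ => C) (D := |C|) fun _ => le_rfl] at h2
  rw [pmfExp_add p (fun x => abs_pmfExp_le (k x) hg) (D := |C|)
    fun x => (by rw [pmfExp_const])] at h2
  simp only [pmfExp_const] at h2
  linarith

theorem pmfExp_mixture {X A : Type*} {H n : ℕ} [NeZero n] (μ : Fin n → DataDist X A H)
    (h : Fin H) {g : X × A → ℝ} {C : ℝ} (hg : ∀ x, |g x| ≤ C) :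
    pmfExp (mixture μ h) g = (1 / (n : ℝ)) * ∑ i, pmfExp (μ i h) g := by
  rw [mixture, pmfExp_bind _ _ hg]
  simp only [pmfExp, tsum_fintype, PMF.uniformOfFintype_apply, Fintype.card_fin,
    ENNReal.toReal_inv, ENNReal.toReal_natCast, Finset.mul_sum, one_div]

/-! ### Clipping -/

theorem clip_zero {c : ℝ} (hc : 0 ≤ c) : clip c 0 = 0 := by
  have : min (0 : EReal) (c : EReal) = 0 := min_eq_left (by exact_mod_cast hc)
  rw [clip, this, max_eq_right, EReal.toReal_zero]
  rw [← EReal.coe_neg]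
  exact_mod_cast neg_nonpos.2 hc

/-- Oddness makes a weight and its negative give the same objective value, so the negated members of
the augmented class need no separate bound. -/
theorem clip_neg {c : ℝ} (hc : 0 ≤ c) (w : EReal) : clip c (-w) = -clip c w := by
  have hcc : (-(c : EReal)) ≤ c := by
    rw [← EReal.coe_neg]
    exact_mod_cast (by linarith : -c ≤ c)
  have h : max (-(c : EReal)) (min (-w) c) = -(max (-(c : EReal)) (min w c)) := by
    rcases le_total w c with h1 | h1 <;> rcases le_total (-(c : EReal)) w with h2 | h2
    · have h3 : -w ≤ c := EReal.neg_le.1 h2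
      rw [min_eq_left h1, max_eq_right h2, min_eq_left h3,
        max_eq_right (EReal.neg_le_neg_iff.2 h1)]
    · have h3 : (c : EReal) ≤ -w := EReal.le_neg.1 h2
      rw [min_eq_left h1, max_eq_left h2, min_eq_right h3, max_eq_right hcc, neg_neg]
    · have h3 : -w ≤ c := EReal.neg_le.1 h2
      rw [min_eq_right h1, max_eq_right hcc, min_eq_left h3,
        max_eq_left (EReal.neg_le_neg_iff.2 h1)]
    · have h3 : (c : EReal) ≤ -w := EReal.le_neg.1 h2
      have h4 : w = c := le_antisymm (h2.trans hcc) h1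
      have h5 : -w ≤ c := by rw [h4]; exact hcc
      rw [min_eq_right h1, max_eq_right hcc, min_eq_left h5, h4, max_self]
  rw [clip, h, EReal.toReal_neg_eq, clip]

theorem clip_coe_ennreal {c : ℝ} (hc : 0 ≤ c) (w : ℝ≥0∞) :
    clip c (w : EReal) = (min w (ENNReal.ofReal c)).toReal := by
  have h1 : (c : EReal) = ((ENNReal.ofReal c : ℝ≥0∞) : EReal) := by
    rw [EReal.coe_ennreal_ofReal, max_eq_left hc]
  have h2 : min (w : EReal) (c : EReal) = ((min w (ENNReal.ofReal c) : ℝ≥0∞) : EReal) := by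
    rw [h1]
    exact (Monotone.map_min (fun a b h => EReal.coe_ennreal_le_coe_ennreal_iff.2 h)).symm
  rw [clip, h2, max_eq_right, EReal.toReal_coe_ennreal]
  refine le_trans ?_ (EReal.coe_ennreal_nonneg _)
  rw [← EReal.coe_neg]
  exact_mod_cast neg_nonpos.2 hc

theorem clip_coe_nonneg {c : ℝ} (hc : 0 ≤ c) (w : ℝ≥0∞) : 0 ≤ clip c (w : EReal) := by
  rw [clip_coe_ennreal hc]
  exact ENNReal.toReal_nonneg

theorem clip_coe_le {c : ℝ} (hc : 0 ≤ c) (w : ℝ≥0∞) : clip c (w : EReal) ≤ c := by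
  rw [clip_coe_ennreal hc]
  calc (min w (ENNReal.ofReal c)).toReal ≤ (ENNReal.ofReal c).toReal :=
        ENNReal.toReal_mono ENNReal.ofReal_ne_top (min_le_right _ _)
    _ = c := ENNReal.toReal_ofReal hc

theorem abs_clip_coe_le {c : ℝ} (hc : 0 ≤ c) (w : ℝ≥0∞) : |clip c (w : EReal)| ≤ c := by
  rw [abs_of_nonneg (clip_coe_nonneg hc w)]
  exact clip_coe_le hc w

/-- Either the density ratio is not clipped, or it is clipped to `c`. -/
theorem clip_densityRatio_cases {X A : Type*} (d ν : PMF (X × A)) {c : ℝ} (hc : 0 ≤ c)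
    (x : X) (a : A) :
    (ν (x, a)).toReal * clip c (densityRatio d ν x a : EReal) = (d (x, a)).toReal ∨
      (ν (x, a)).toReal * c ≤ (d (x, a)).toReal ∧ clip c (densityRatio d ν x a : EReal) = c := by
  rw [clip_coe_ennreal hc]
  rcases le_total (ENNReal.ofReal c) (densityRatio d ν x a) with h | h
  · by_cases h0 : ν (x, a) = 0
    -- At a null point of ν the convention is harmless: 0/0 = 1 is multiplied by zero mass, and c/0
    -- = ∞ is clipped to c.
    · by_cases h1 : d (x, a) = 0
      · left; simp [h0, h1]
      · right
        simp [h0, h1, densityRatio, ENNReal.toReal_ofReal hc]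
    · right
      rw [min_eq_right h, ENNReal.toReal_ofReal hc]
      refine ⟨?_, rfl⟩
      rw [densityRatio, if_neg h0,
        ENNReal.le_div_iff_mul_le (Or.inl h0) (Or.inl (ν.apply_ne_top _))] at h
      have := ENNReal.toReal_mono (d.apply_ne_top _) h
      rwa [ENNReal.toReal_mul, ENNReal.toReal_ofReal hc, mul_comm] at this
  · left
    rw [min_eq_left h, densityRatio]
    by_cases h0 : ν (x, a) = 0
    · by_cases h1 : d (x, a) = 0
      · simp [h0, h1]
      · simp [h0, h1, densityRatio] at h
    · rw [if_neg h0, ← ENNReal.toReal_mul, ENNReal.mul_div_cancel h0 (ν.apply_ne_top _)]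

theorem mul_clip_densityRatio_le {X A : Type*} (d ν : PMF (X × A)) {c : ℝ} (hc : 0 ≤ c)
    (p : X × A) :
    (ν p).toReal * clip c (densityRatio d ν p.1 p.2 : EReal) ≤ (d p).toReal := by
  rcases clip_densityRatio_cases d ν hc p.1 p.2 with h | ⟨h, h'⟩
  · exact h.le
  · rw [h']; exact h

/-- Mass is lost only where the ratio is clipped, and there the factor clip/c equals 1; this is a
pointwise Markov inequality. -/
theorem sub_mul_clip_densityRatio_le {X A : Type*} (d ν : PMF (X × A)) {c : ℝ} (hc : 0 < c)
    (p : X × A) :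
    (d p).toReal - (ν p).toReal * clip c (densityRatio d ν p.1 p.2 : EReal) ≤
      (d p).toReal * clip c (densityRatio d ν p.1 p.2 : EReal) / c := by
  rcases clip_densityRatio_cases d ν hc.le p.1 p.2 with h | ⟨h, h'⟩
  · rw [h, sub_self]
    exact div_nonneg (mul_nonneg ENNReal.toReal_nonneg (clip_coe_nonneg hc.le _)) hc.le
  · rw [h', mul_div_assoc, div_self hc.ne', mul_one, sub_le_self_iff]
    exact mul_nonneg ENNReal.toReal_nonneg hc.le

/-- One of the two clip factors is spent on changing the measure from ν to d. -/
theorem pmfExp_clip_sq_le {X A : Type*} (d ν : PMF (X × A)) {c : ℝ} (hc : 0 ≤ c) :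
    pmfExp ν (fun p => clip c (densityRatio d ν p.1 p.2 : EReal) ^ 2) ≤
      pmfExp d fun p => clip c (densityRatio d ν p.1 p.2 : EReal) := by
  refine Summable.tsum_le_tsum (fun p => ?_)
    (ν.summable_toReal_mul (C := c ^ 2) fun p => ?_)
    (d.summable_toReal_mul fun p => abs_clip_coe_le hc _)
  · simp only [pow_two, ← mul_assoc]
    exact mul_le_mul_of_nonneg_right (mul_clip_densityRatio_le d ν hc p) (clip_coe_nonneg hc _)
  · rw [abs_pow]
    exact pow_le_pow_left₀ (abs_nonneg _) (abs_clip_coe_le hc _) 2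

theorem abs_pmfExp_sub_clip_le {X A : Type*} (d ν : PMF (X × A)) {c : ℝ} (hc : 0 < c)
    {g : X × A → ℝ} {B : ℝ} (hg : ∀ p, |g p| ≤ B) :
    |pmfExp d g - pmfExp ν fun p => clip c (densityRatio d ν p.1 p.2 : EReal) * g p| ≤
      B / c * pmfExp d fun p => clip c (densityRatio d ν p.1 p.2 : EReal) := by
  have hs : ∀ p, |clip c (densityRatio d ν p.1 p.2 : EReal) * g p| ≤ c * B := fun p => by
    rw [abs_mul]
    exact mul_le_mul (abs_clip_coe_le hc.le _) (hg p) (abs_nonneg _) hc.le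
  rw [pmfExp, pmfExp, ← (d.summable_toReal_mul hg).tsum_sub (ν.summable_toReal_mul hs),
    ← pmfExp_const_mul, ← Real.norm_eq_abs]
  refine tsum_of_norm_bounded (d.summable_toReal_mul (C := |B / c| * c) fun p => ?_).hasSum
    fun p => ?_
  · rw [abs_mul]
    exact mul_le_mul_of_nonneg_left (abs_clip_coe_le hc.le _) (abs_nonneg _)
  · have h1 := sub_mul_clip_densityRatio_le d ν hc p
    have h2 := mul_clip_densityRatio_le d ν hc.le p
    rw [← mul_assoc, ← sub_mul, Real.norm_eq_abs, abs_mul, abs_of_nonneg (sub_nonneg.2 h2)]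
    calc _ ≤ (d p).toReal * clip c (densityRatio d ν p.1 p.2 : EReal) / c * B :=
          mul_le_mul h1 (hg p) (abs_nonneg _)
            (div_nonneg (mul_nonneg ENNReal.toReal_nonneg (clip_coe_nonneg hc.le _)) hc.le)
      _ = _ := by ring

/-! ### Value functions and occupancy measures of deterministic policies -/

namespace EpisodicMDP

variable {X A : Type*} {H : ℕ} (M : EpisodicMDP X A H)

theorem integrable_reward (h : Fin H) (x : X) (a : A) :
    Integrable (fun r : ℝ => r) (M.R h x a) := by
  have := M.R_prob h x a
  refine Integrable.of_bound aestronglyMeasurable_id 1 ?_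
  filter_upwards [M.R_mem h x a] with r hr
  rw [Real.norm_eq_abs, abs_of_nonneg hr.1]
  exact hr.2

theorem meanReward_mem (h : Fin H) (x : X) (a : A) : M.meanReward h x a ∈ Set.Icc (0 : ℝ) 1 := by
  have := M.R_prob h x a
  constructor
  · exact integral_nonneg_of_ae ((M.R_mem h x a).mono fun r hr => hr.1)
  · calc M.meanReward h x a ≤ ∫ _, (1 : ℝ) ∂(M.R h x a) :=
          integral_mono_ae (M.integrable_reward h x a) (integrable_const _)
            ((M.R_mem h x a).mono fun r hr => hr.2)
      _ = 1 := by simp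

theorem V_toRand (π : DetPolicy X A H) {i : ℕ} (hi : i < H) (x : X) :
    M.V π.toRand i x = M.meanReward ⟨i, hi⟩ x (π ⟨i, hi⟩ x) +
      pmfExp (M.P ⟨i, hi⟩ x (π ⟨i, hi⟩ x)) (M.V π.toRand (i + 1)) := by
  rw [V, dif_pos hi]
  exact pmfExp_pure (π ⟨i, hi⟩ x) fun a => M.meanReward ⟨i, hi⟩ x a +
      pmfExp (M.P ⟨i, hi⟩ x a) (M.V π.toRand (i + 1))

theorem V_of_le (π : RandPolicy X A H) {i : ℕ} (hi : H ≤ i) (x : X) : M.V π i x = 0 := by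
  rw [V, dif_neg hi.not_gt]

theorem abs_V_toRand_le (π : DetPolicy X A H) (i : ℕ) (x : X) :
    |M.V π.toRand i x| ≤ ((H - i : ℕ) : ℝ) := by
  induction hk : H - i generalizing i x with
  | zero => simp [M.V_of_le _ (Nat.sub_eq_zero_iff_le.1 hk)]
  | succ k ih =>
    have hi : i < H := by omega
    rw [M.V_toRand π hi, Nat.cast_succ, add_comm (k : ℝ)]
    refine (abs_add_le _ _).trans (add_le_add ?_ (abs_pmfExp_le _ fun x' => ih (i + 1) x' ?_))
    · have := M.meanReward_mem ⟨i, hi⟩ x (π ⟨i, hi⟩ x)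
      rw [abs_of_nonneg this.1]
      exact this.2
    · omega

theorem abs_V_toRand_le_horizon (π : DetPolicy X A H) (i : ℕ) (x : X) :
    |M.V π.toRand i x| ≤ (H : ℝ) :=
  (M.abs_V_toRand_le π i x).trans (Nat.cast_le.2 (Nat.sub_le _ _))

theorem pmfExp_stateLaw_succ (π : DetPolicy X A H) {i : ℕ} (hi : i < H) {g : X → ℝ} {C : ℝ}
    (hg : ∀ x, |g x| ≤ C) :
    pmfExp (M.stateLaw π.toRand (i + 1)) g =
      pmfExp (M.stateLaw π.toRand i) fun x => pmfExp (M.P ⟨i, hi⟩ x (π ⟨i, hi⟩ x)) g := by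
  rw [stateLaw, dif_pos hi, pmfExp_bind _ _ hg]
  simp only [DetPolicy.toRand, PMF.pure_bind]

theorem pmfExp_occ (π : DetPolicy X A H) (h : Fin H) {g : X × A → ℝ} {C : ℝ}
    (hg : ∀ p, |g p| ≤ C) :
    pmfExp (M.occ π.toRand h) g =
      pmfExp (M.stateLaw π.toRand h) fun x => g (x, π h x) := by
  rw [occ, pmfExp_bind _ _ hg]
  simp only [DetPolicy.toRand, PMF.pure_map, pmfExp_pure]

/-- The expected gap between the value of `π` and any bounded function `u` which vanishes after
the last layer is the sum of the expected one-step gaps along the trajectory of `π`. -/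
theorem J_sub_pmfExp_eq_sum (π : DetPolicy X A H) {u : ℕ → X → ℝ} {C : ℝ}
    (hu : ∀ i x, |u i x| ≤ C) (hH : ∀ x, u H x = 0) :
    M.J π.toRand - pmfExp M.init (u 0) =
      ∑ h : Fin H, pmfExp (M.stateLaw π.toRand h) fun x =>
        M.meanReward h x (π h x) + pmfExp (M.P h x (π h x)) (u (h + 1)) - u h x := by
  have hV := M.abs_V_toRand_le_horizon π
  have hd : ∀ i x, |M.V π.toRand i x - u i x| ≤ H + C := fun i x =>
    (abs_sub _ _).trans (add_le_add (hV i x) (hu i x))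
  -- Telescoping up to layer k, with the expected gap in layer k as remainder; at k = H both
  -- functions in the remainder vanish.
  have key : ∀ k (hk : k ≤ H), pmfExp M.init (fun x => M.V π.toRand 0 x - u 0 x) =
      (∑ i : Fin k, pmfExp (M.stateLaw π.toRand i) fun x =>
        M.meanReward (Fin.castLE hk i) x (π (Fin.castLE hk i) x) +
          pmfExp (M.P (Fin.castLE hk i) x (π (Fin.castLE hk i) x)) (u (i + 1)) - u i x) +
        pmfExp (M.stateLaw π.toRand k) fun x => M.V π.toRand k x - u k x := by
    intro k
    induction k with
    | zero => intro _; simp [stateLaw]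
    | succ k ih =>
      intro hk
      have hk' : k < H := hk
      rw [ih hk'.le, Fin.sum_univ_castSucc, add_assoc, M.pmfExp_stateLaw_succ π hk' (hd _)]
      refine congrArg₂ _ rfl (Eq.trans (congrArg _ (funext fun x => ?_))
        (pmfExp_add (M.stateLaw π.toRand k) (C := 1 + C + C) (D := H + C) ?_ ?_))
      · rw [M.V_toRand π hk', pmfExp_sub _ (hV _) (hu _)]
        simp only [Fin.castLE, Fin.last]
        ring
      · intro x
        refine (abs_sub _ _).trans (add_le_add ((abs_add_le _ _).trans (add_le_add ?_
          (abs_pmfExp_le _ (hu _)))) (hu _ x))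
        have := M.meanReward_mem (Fin.castLE hk (Fin.last k)) x
          (π (Fin.castLE hk (Fin.last k)) x)
        rw [abs_of_nonneg this.1]
        exact this.2
      · exact fun x => abs_pmfExp_le _ (hd _)
  have h := key H le_rfl
  rw [pmfExp_sub _ (hV 0) (hu 0)] at h
  simp only [M.V_of_le π.toRand le_rfl, hH, sub_zero, pmfExp_const, add_zero] at h
  exact h

/-- The Bellman error of `f` with respect to the greedy backup. -/
noncomputable def bellmanErr (f : Fin H → X → A → ℝ) (h : Fin H) (p : X × A) : ℝ :=
  f h p.1 p.2 - M.meanReward h p.1 p.2 - pmfExp (M.P h p.1 p.2) (nextMax f h)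

/-- The state value `max_a f_i(x, a)`, which is zero after the last layer. -/
noncomputable def maxVal (f : Fin H → X → A → ℝ) (i : ℕ) (x : X) : ℝ :=
  if hi : i < H then ⨆ a, f ⟨i, hi⟩ x a else 0

theorem iSup_eq_of_forall_le {g : A → ℝ} {a : A} (h : ∀ b, g b ≤ g a) : ⨆ b, g b = g a :=
  haveI : Nonempty A := ⟨a⟩
  le_antisymm (ciSup_le h) (le_ciSup (f := g) ⟨g a, by rintro _ ⟨b, rfl⟩; exact h b⟩ a)

section Greedy

variable {f : Fin H → X → A → ℝ} (hf : ∀ h x a, f h x a ∈ Set.Icc (0 : ℝ) 1)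
  {π : DetPolicy X A H} (hπ : ∀ h x a, f h x a ≤ f h x (π h x))

include hπ in
theorem maxVal_eq (h : Fin H) (x : X) : maxVal f h x = f h x (π h x) := by
  rw [maxVal, dif_pos h.2]
  exact iSup_eq_of_forall_le (hπ h x)

include hf hπ in
theorem maxVal_mem (i : ℕ) (x : X) : maxVal f i x ∈ Set.Icc (0 : ℝ) 1 := by
  by_cases hi : i < H
  · rw [maxVal_eq hπ ⟨i, hi⟩]
    exact hf _ _ _
  · rw [maxVal, dif_neg hi]
    simp

include hf hπ in
theorem nextMax_mem (h : Fin H) (x : X) : nextMax f h x ∈ Set.Icc (0 : ℝ) 1 :=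
  -- `nextMax f h` unfolds to `maxVal f (h + 1)`.
  maxVal_mem hf hπ (h + 1) x

include hf hπ in
theorem abs_nextMax_le (h : Fin H) (x : X) : |nextMax f h x| ≤ 1 := by
  have := nextMax_mem hf hπ h x
  rw [abs_of_nonneg this.1]
  exact this.2

include hf hπ in
theorem abs_bellmanErr_le (h : Fin H) (p : X × A) : |M.bellmanErr f h p| ≤ 2 := by
  have h1 := hf h p.1 p.2
  have h2 := M.meanReward_mem h p.1 p.2
  have h3 := abs_pmfExp_le (M.P h p.1 p.2) (abs_nextMax_le hf hπ h)
  have h4 := pmfExp_nonneg (M.P h p.1 p.2) fun x => (nextMax_mem hf hπ h x).1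
  rw [abs_of_nonneg h4] at h3
  rw [bellmanErr, abs_le]
  constructor <;> linarith [h1.1, h1.2, h2.1, h2.2]

include hf hπ in
/-- The suboptimality of the greedy policy `π` of `f` relative to any deterministic policy is
controlled by the Bellman errors of `f` along both policies. -/
theorem J_sub_J_greedy_le (ρ : DetPolicy X A H) :
    M.J ρ.toRand - M.J π.toRand ≤
      ∑ h, (pmfExp (M.occ π.toRand h) (M.bellmanErr f h) -
        pmfExp (M.occ ρ.toRand h) (M.bellmanErr f h)) := by
  have hb : ∀ i x, |maxVal f i x| ≤ 1 := fun i x => by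
    have := maxVal_mem hf hπ i x
    rw [abs_of_nonneg this.1]
    exact this.2
  have hH : ∀ x, maxVal f H x = 0 := fun x => by rw [maxVal, dif_neg (lt_irrefl H)]
  have hE := M.abs_bellmanErr_le hf hπ
  have h1 := M.J_sub_pmfExp_eq_sum π hb hH
  have h2 := M.J_sub_pmfExp_eq_sum ρ hb hH
  -- Along π the maximum is attained by the action played, so the one-step gap is exactly minus the
  -- Bellman error.
  have h3 : ∀ h : Fin H, (pmfExp (M.stateLaw π.toRand h) fun x =>
      M.meanReward h x (π h x) + pmfExp (M.P h x (π h x)) (maxVal f (h + 1)) - maxVal f h x) =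
        -pmfExp (M.occ π.toRand h) (M.bellmanErr f h) := fun h => by
    rw [M.pmfExp_occ π h (hE h), ← neg_one_mul, ← pmfExp_const_mul]
    refine congrArg _ (funext fun x => ?_)
    rw [maxVal_eq hπ, bellmanErr]
    change _ = -1 * (_ - _ - pmfExp (M.P h x (π h x)) (maxVal f (h + 1)))
    ring
  -- Along ρ the action may be suboptimal for f, so max_a f only dominates f at that action and an
  -- inequality remains. The common initial term cancels between `h1` and `h2`.
  have h4 : ∀ h : Fin H, (pmfExp (M.stateLaw ρ.toRand h) fun x =>
      M.meanReward h x (ρ h x) + pmfExp (M.P h x (ρ h x)) (maxVal f (h + 1)) - maxVal f h x) ≤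
        -pmfExp (M.occ ρ.toRand h) (M.bellmanErr f h) := fun h => by
    rw [M.pmfExp_occ ρ h (hE h), ← neg_one_mul, ← pmfExp_const_mul]
    refine pmfExp_mono _ (C := 1 + 1 + 1) (D := 2) (fun x => ?_) (fun x => ?_) fun x => ?_
    · refine (abs_sub _ _).trans (add_le_add ((abs_add_le _ _).trans (add_le_add ?_
        (abs_pmfExp_le _ (hb _)))) (hb _ x))
      have := M.meanReward_mem h x (ρ h x)
      rw [abs_of_nonneg this.1]
      exact this.2
    · rw [neg_one_mul, abs_neg]
      exact hE h _
    · rw [maxVal_eq hπ, bellmanErr]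
      have := hπ h x (ρ h x)
      change _ ≤ -1 * (_ - _ - pmfExp (M.P h x (ρ h x)) (maxVal f (h + 1)))
      dsimp only
      linarith
  rw [Finset.sum_congr rfl fun h _ => h3 h] at h1
  have h5 := Finset.sum_le_sum fun h (_ : h ∈ Finset.univ) => h4 h
  rw [Finset.sum_neg_distrib] at h1 h5
  rw [Finset.sum_sub_distrib]
  linarith

end Greedy

theorem V_eq_Q (π : DetPolicy X A H) (h : Fin H) (x : X) :
    M.V π.toRand h x = M.Q π.toRand h x (π h x) :=
  M.V_toRand π h.2 x

theorem V_toRand_congr {π ρ : DetPolicy X A H} {i : ℕ}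
    (hπ : ∀ h : Fin H, i ≤ h → π h = ρ h) (x : X) : M.V π.toRand i x = M.V ρ.toRand i x := by
  induction hk : H - i generalizing i x with
  | zero =>
    have hi := Nat.sub_eq_zero_iff_le.1 hk
    rw [M.V_of_le _ hi, M.V_of_le _ hi]
  | succ k ih =>
    have hi : i < H := by omega
    rw [M.V_toRand π hi, M.V_toRand ρ hi, hπ ⟨i, hi⟩ le_rfl]
    refine congrArg₂ _ rfl (congrArg _ (funext fun x' => ?_))
    exact ih (fun h hh => hπ h (by omega)) x' (by omega)

variable {M}

/-- One-shot deviation: a policy that plays `a` throughout layer h and follows π⋆ elsewhere cannot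
beat π⋆ at (h, x), and its later layers are those of π⋆. -/
theorem IsOptimal.Q_le {πstar : DetPolicy X A H} (hopt : M.IsOptimal πstar) (h : Fin H) (x : X)
    (a : A) : M.Q πstar.toRand h x a ≤ M.Q πstar.toRand h x (πstar h x) := by
  let ρ : DetPolicy X A H := fun h' => if h' = h then fun _ => a else πstar h'
  have h1 : M.V ρ.toRand h x = M.Q πstar.toRand h x a := by
    have h2 : ρ h x = a := by simp [ρ]
    rw [V_eq_Q, h2, Q, Q]
    refine congrArg₂ _ rfl (tsum_congr fun x' => ?_)
    rw [M.V_toRand_congr (π := ρ) (ρ := πstar) fun h' hh => ?_]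
    have : h' ≠ h := fun e => by rw [e] at hh; omega
    simp [ρ, this]
  rw [← h1, ← V_eq_Q]
  exact hopt ρ.toRand h x

theorem IsOptimal.bellmanErr_Q {πstar : DetPolicy X A H} (hopt : M.IsOptimal πstar) (h : Fin H)
    (p : X × A) : M.bellmanErr (M.Q πstar.toRand) h p = 0 := by
  have h1 : nextMax (M.Q πstar.toRand) h = M.V πstar.toRand (h + 1) := by
    funext x
    rw [nextMax]
    split_ifs with hh
    · rw [iSup_eq_of_forall_le (hopt.Q_le ⟨h + 1, hh⟩ x), ← V_eq_Q]
    · rw [V_of_le _ _ (not_lt.1 hh)]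
  rw [bellmanErr, h1, Q, pmfExp]
  ring

end EpisodicMDP

/-! ### Concentration for adaptively collected data -/

/-- A product of factors, each of which does not increase integrals against weights determined by
the past, has integral at most one. -/
theorem lintegral_prod_le_one {Ω : Type*} [mΩ : MeasurableSpace Ω] (ℙ : Measure Ω)
    [IsProbabilityMeasure ℙ] (ℱ : Filtration ℕ mΩ) {n : ℕ} (Y : Fin n → Ω → ℝ≥0∞)
    (hY : ∀ i : Fin n, Measurable[ℱ ((i : ℕ) + 1)] (Y i))
    (h : ∀ (i : Fin n) (Z : Ω → ℝ≥0∞), Measurable[ℱ (i : ℕ)] Z →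
      ∫⁻ ω, Z ω * Y i ω ∂ℙ ≤ ∫⁻ ω, Z ω ∂ℙ) :
    ∫⁻ ω, ∏ i, Y i ω ∂ℙ ≤ 1 := by
  induction n with
  | zero => simp
  | succ n ih =>
    simp only [Fin.prod_univ_castSucc]
    -- The last factor is removed first: the product of the earlier ones is already known before the
    -- last round.
    refine (h (Fin.last n) _ ?_).trans
      (ih (fun i => Y i.castSucc) (fun i => hY i.castSucc) fun i => h i.castSucc)
    refine Finset.measurable_fun_prod _ fun i _ => (hY i.castSucc).mono (ℱ.mono ?_) le_rfl
    exact i.2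

theorem measurable_tsum_mul {Ω α : Type*} [Countable α] {_ : MeasurableSpace Ω}
    {ν : Ω → PMF α} (hν : ∀ p, Measurable fun ω => ν ω p) (c : α → ℝ≥0∞) :
    Measurable fun ω => ∑' p, ν ω p * c p :=
  Measurable.tsum fun p => (hν p).mul_const _

theorem measurable_pmfExp {Ω α : Type*} [Countable α] {_ : MeasurableSpace Ω}
    {ν : Ω → PMF α} (hν : ∀ p, Measurable fun ω => ν ω p) (g : α → ℝ) :
    Measurable fun ω => pmfExp (ν ω) g :=
  Measurable.tsum fun p => (hν p).ennreal_toReal.mul_const _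

namespace EpisodicMDP

variable {X A : Type*} [Countable X] [Countable A]
  [MeasurableSpace X] [MeasurableSingletonClass X]
  [MeasurableSpace A] [MeasurableSingletonClass A] {H : ℕ} {M : EpisodicMDP X A H}

variable (M) in
/-- The law of reward and next state given a state-action pair. -/
noncomputable def outcomeLaw (h : Fin H) (p : X × A) : Measure (ℝ × X) :=
  (M.R h p.1 p.2).prod (M.P h p.1 p.2).toMeasure

instance (h : Fin H) (p : X × A) : IsProbabilityMeasure (M.outcomeLaw h p) := by
  have := M.R_prob h p.1 p.2
  unfold outcomeLaw
  infer_instance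

omit [Countable X] [MeasurableSingletonClass X] [Countable A] [MeasurableSingletonClass A] in
theorem lintegral_sampleLaw (h : Fin H) (ν : PMF (X × A)) {φ : Sample X A → ℝ≥0∞}
    (hφ : Measurable φ) :
    ∫⁻ z, φ z ∂(M.sampleLaw h ν) =
      ∑' p, ν p * ∫⁻ q, φ (p.1, p.2, q.1, q.2) ∂(M.outcomeLaw h p) := by
  rw [sampleLaw, lintegral_sum_measure]
  refine tsum_congr fun p => ?_
  rw [lintegral_smul_measure, lintegral_map hφ (by fun_prop)]
  rfl

/-! ### Conditional laws and exponential tail bound under adaptive sampling -/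

namespace IsAdaptiveSample

variable {Ω : Type uΩ} [mΩ : MeasurableSpace Ω] {ℙ : Measure Ω} {ℱ : Filtration ℕ mΩ} {n : ℕ}
  {μ : Fin n → Ω → DataDist X A H} {D : Ω → Dataset X A H n}

omit [MeasurableSingletonClass X] [MeasurableSingletonClass A] in
theorem measurable_lintegral (hD : M.IsAdaptiveSample ℙ ℱ μ D) (i : Fin n) (h : Fin H)
    {φ : Sample X A → ℝ≥0∞} (hφ : Measurable φ) :
    Measurable[ℱ (i : ℕ)] fun ω => ∫⁻ z, φ z ∂(M.sampleLaw h (μ i ω h)) := by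
  simp only [lintegral_sampleLaw h _ hφ]
  exact measurable_tsum_mul (fun p => hD.predictable i h p) _

omit [MeasurableSingletonClass X] [MeasurableSingletonClass A] in
-- `condLaw` is the case of indicators; linearity and monotone limits give the rest.
theorem setLIntegral_eq (hD : M.IsAdaptiveSample ℙ ℱ μ D) (i : Fin n) (h : Fin H)
    {E : Set Ω} (hE : MeasurableSet[ℱ (i : ℕ)] E) {φ : Sample X A → ℝ≥0∞} (hφ : Measurable φ) :
    ∫⁻ ω in E, φ (D ω i h) ∂ℙ = ∫⁻ ω in E, ∫⁻ z, φ z ∂(M.sampleLaw h (μ i ω h)) ∂ℙ := by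
  have hm : Measurable fun ω => D ω i h := (hD.adapted i h).mono (ℱ.le _) le_rfl
  have hl : ∀ {ψ : Sample X A → ℝ≥0∞}, Measurable ψ →
      Measurable fun ω => ∫⁻ z, ψ z ∂(M.sampleLaw h (μ i ω h)) :=
    fun hψ => (hD.measurable_lintegral i h hψ).mono (ℱ.le _) le_rfl
  refine Measurable.ennreal_induction (motive := fun φ => ∫⁻ ω in E, φ (D ω i h) ∂ℙ =
    ∫⁻ ω in E, ∫⁻ z, φ z ∂(M.sampleLaw h (μ i ω h)) ∂ℙ) ?_ ?_ ?_ hφ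
  · intro c S hS
    have h1 : ∀ ω, ∫⁻ z, S.indicator (fun _ => c) z ∂(M.sampleLaw h (μ i ω h)) =
        c * M.sampleLaw h (μ i ω h) S := fun ω => lintegral_indicator_const hS c
    have h2 : ∀ ω, S.indicator (fun _ => c) (D ω i h) =
        ({ω | D ω i h ∈ S}).indicator (fun _ => c) ω := fun ω => rfl
    have h3 : Measurable fun ω => M.sampleLaw h (μ i ω h) S := by
      have := hl (measurable_one.indicator hS : Measurable (S.indicator (1 : Sample X A → ℝ≥0∞)))
      simpa only [lintegral_indicator_one hS] using this
    simp only [h1, h2]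
    rw [lintegral_indicator_const (s := {ω | D ω i h ∈ S}) (hm hS), lintegral_const_mul _ h3, ← hD.condLaw i h E hE S hS,
      Measure.restrict_apply (t := {ω | D ω i h ∈ S}) (hm hS), Set.inter_comm]
  · intro f g _ hf hg ihf ihg
    simp only [Pi.add_apply, lintegral_add_left hf]
    have hfm : Measurable fun ω => f (D ω i h) := hf.comp hm
    rw [lintegral_add_left hfm, lintegral_add_left (hl hf), ihf, ihg]
  · intro f hf hmono ih
    simp only [lintegral_iSup hf hmono]
    have hfm : ∀ k, Measurable fun ω => f k (D ω i h) := fun k => (hf k).comp hm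
    rw [lintegral_iSup hfm fun a b hab ω => hmono hab _,
      lintegral_iSup (fun k => hl (hf k)) fun a b hab ω => lintegral_mono (hmono hab)]
    simp only [ih]

omit [MeasurableSingletonClass X] [MeasurableSingletonClass A] in
theorem lintegral_mul_eq (hD : M.IsAdaptiveSample ℙ ℱ μ D) (i : Fin n) (h : Fin H)
    {Z : Ω → ℝ≥0∞} (hZ : Measurable[ℱ (i : ℕ)] Z) {φ : Sample X A → ℝ≥0∞} (hφ : Measurable φ) :
    ∫⁻ ω, Z ω * φ (D ω i h) ∂ℙ =
      ∫⁻ ω, Z ω * ∫⁻ z, φ z ∂(M.sampleLaw h (μ i ω h)) ∂ℙ := by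
  have hm : Measurable fun ω => φ (D ω i h) :=
    hφ.comp ((hD.adapted i h).mono (ℱ.le _) le_rfl)
  have hl : Measurable fun ω => ∫⁻ z, φ z ∂(M.sampleLaw h (μ i ω h)) :=
    (hD.measurable_lintegral i h hφ).mono (ℱ.le _) le_rfl
  have hle : ∀ {g : Ω → ℝ≥0∞}, Measurable[ℱ (i : ℕ)] g → Measurable g :=
    fun hg => hg.mono (ℱ.le _) le_rfl
  refine Measurable.ennreal_induction (motive := fun Z => ∫⁻ ω, Z ω * φ (D ω i h) ∂ℙ =
    ∫⁻ ω, Z ω * ∫⁻ z, φ z ∂(M.sampleLaw h (μ i ω h)) ∂ℙ) ?_ ?_ ?_ hZ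
  · intro c E hE
    have h1 : ∀ (g : Ω → ℝ≥0∞) ω, E.indicator (fun _ => c) ω * g ω =
        E.indicator (fun ω => c * g ω) ω := fun g ω => by
      by_cases hω : ω ∈ E <;> simp [hω]
    have hE' : MeasurableSet E := ℱ.le _ _ hE
    rw [lintegral_congr (h1 fun ω => φ (D ω i h)),
      lintegral_congr (h1 fun ω => ∫⁻ z, φ z ∂(M.sampleLaw h (μ i ω h))),
      lintegral_indicator hE', lintegral_indicator hE', lintegral_const_mul _ hm,
      lintegral_const_mul _ hl, hD.setLIntegral_eq i h hE hφ]
  · intro f g _ hf hg ihf ihg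
    simp only [Pi.add_apply, add_mul]
    have hfm : Measurable fun ω => f ω * φ (D ω i h) := (hle hf).mul hm
    have hfl : Measurable fun ω => f ω * ∫⁻ z, φ z ∂(M.sampleLaw h (μ i ω h)) := (hle hf).mul hl
    rw [lintegral_add_left hfm, lintegral_add_left hfl, ihf, ihg]
  · intro f hf hmono ih
    simp only [ENNReal.iSup_mul]
    have hfm : ∀ k, Measurable fun ω => f k ω * φ (D ω i h) := fun k => (hle (hf k)).mul hm
    have hfl : ∀ k, Measurable fun ω => f k ω * ∫⁻ z, φ z ∂(M.sampleLaw h (μ i ω h)) :=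
      fun k => (hle (hf k)).mul hl
    rw [lintegral_iSup hfm fun a b hab ω => mul_le_mul_left (hmono hab ω) _,
      lintegral_iSup hfl fun a b hab ω => mul_le_mul_left (hmono hab ω) _]
    simp only [ih]

omit [Countable X] [MeasurableSingletonClass X] [Countable A] [MeasurableSingletonClass A] in
-- The conditional bounds 1 + B are averaged over ν, and then 1 + x ≤ exp x. The lower bound on B
-- keeps 1 + B nonnegative, so that `ENNReal.ofReal` commutes with the average.
theorem lintegral_exp_sampleLaw_le (h : Fin H) (ν : PMF (X × A)) {G : Sample X A → ℝ}
    (hG : Measurable G) {B : X × A → ℝ} {C : ℝ} (hB : ∀ p, |B p| ≤ C) (hB' : ∀ p, -1 ≤ B p)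
    (hGB : ∀ p, ∫⁻ q, ENNReal.ofReal (Real.exp (G (p.1, p.2, q.1, q.2))) ∂(M.outcomeLaw h p) ≤
      ENNReal.ofReal (1 + B p)) :
    ∫⁻ z, ENNReal.ofReal (Real.exp (G z)) ∂(M.sampleLaw h ν) ≤
      ENNReal.ofReal (Real.exp (pmfExp ν B)) := by
  have h1 : ∀ p : X × A, |(fun _ : X × A => (1 : ℝ)) p| ≤ 1 := fun p => by simp
  calc ∫⁻ z, ENNReal.ofReal (Real.exp (G z)) ∂(M.sampleLaw h ν)
      = ∑' p, ν p * ∫⁻ q, ENNReal.ofReal (Real.exp (G (p.1, p.2, q.1, q.2)))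
          ∂(M.outcomeLaw h p) := lintegral_sampleLaw h ν hG.exp.ennreal_ofReal
    _ ≤ ∑' p, ν p * ENNReal.ofReal (1 + B p) :=
        ENNReal.tsum_le_tsum fun p => mul_le_mul_right (hGB p) _
    _ = ENNReal.ofReal (pmfExp ν fun p => 1 + B p) :=
        (ofReal_pmfExp ν (C := 1 + C)
          (fun p => (abs_add_le _ _).trans (add_le_add (h1 p) (hB p)))
          fun p => by linarith [hB' p]).symm
    _ ≤ ENNReal.ofReal (Real.exp (pmfExp ν B)) := by
        rw [pmfExp_add ν h1 hB, pmfExp_const]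
        refine ENNReal.ofReal_le_ofReal ?_
        linarith [Real.add_one_le_exp (pmfExp ν B)]

omit [MeasurableSingletonClass X] [MeasurableSingletonClass A] in
/-- An exponential tail bound: if the conditional moment generating function of `G` given the
state-action pair is at most `1 + B`, the sum of `G` over the samples exceeds the sum of the
conditional expectations of `B` by `ℓ` with probability at most `exp (-ℓ)`. -/
theorem measure_le_exp_neg (hD : M.IsAdaptiveSample ℙ ℱ μ D) [IsProbabilityMeasure ℙ]
    (h : Fin H) {G : Sample X A → ℝ}
    (hG : Measurable G) {B : X × A → ℝ} {C : ℝ} (hB : ∀ p, |B p| ≤ C) (hB' : ∀ p, -1 ≤ B p)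
    (hGB : ∀ p, ∫⁻ q, ENNReal.ofReal (Real.exp (G (p.1, p.2, q.1, q.2))) ∂(M.outcomeLaw h p) ≤
      ENNReal.ofReal (1 + B p)) (ℓ : ℝ) :
    ℙ {ω | ℓ ≤ ∑ i, (G (D ω i h) - pmfExp (μ i ω h) B)} ≤ ENNReal.ofReal (Real.exp (-ℓ)) := by
  have hb : ∀ i : Fin n, Measurable[ℱ (i : ℕ)] fun ω => pmfExp (μ i ω h) B := fun i =>
    measurable_pmfExp (fun p => hD.predictable i h p) B
  -- The increments of the exponential supermartingale: dividing by exp of the predictable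
  -- compensator makes the conditional mean at most 1. Markov's inequality for their product then
  -- gives the tail.
  let Y : Fin n → Ω → ℝ≥0∞ := fun i ω =>
    ENNReal.ofReal (Real.exp (G (D ω i h) - pmfExp (μ i ω h) B))
  have hY : ∀ i : Fin n, Measurable[ℱ ((i : ℕ) + 1)] (Y i) := fun i =>
    ((hG.comp (hD.adapted i h)).sub
      ((hb i).mono (ℱ.mono (Nat.le_succ _)) le_rfl)).exp.ennreal_ofReal
  have hYm : Measurable fun ω => ∏ i, Y i ω :=
    Finset.measurable_fun_prod _ fun i _ => (hY i).mono (ℱ.le _) le_rfl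
  have hprod : ∫⁻ ω, ∏ i, Y i ω ∂ℙ ≤ 1 := by
    refine lintegral_prod_le_one ℙ ℱ Y hY fun i Z hZ => ?_
    have hE : Measurable[ℱ (i : ℕ)] fun ω => ENNReal.ofReal (Real.exp (-pmfExp (μ i ω h) B)) :=
      (hb i).neg.exp.ennreal_ofReal
    calc ∫⁻ ω, Z ω * Y i ω ∂ℙ
        = ∫⁻ ω, (Z ω * ENNReal.ofReal (Real.exp (-pmfExp (μ i ω h) B))) *
            ENNReal.ofReal (Real.exp (G (D ω i h))) ∂ℙ := by
          refine lintegral_congr fun ω => ?_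
          rw [mul_assoc, ← ENNReal.ofReal_mul (Real.exp_nonneg _), ← Real.exp_add,
            neg_add_eq_sub]
      _ = ∫⁻ ω, (Z ω * ENNReal.ofReal (Real.exp (-pmfExp (μ i ω h) B))) *
            ∫⁻ z, ENNReal.ofReal (Real.exp (G z)) ∂(M.sampleLaw h (μ i ω h)) ∂ℙ :=
          hD.lintegral_mul_eq i h (hZ.mul hE) hG.exp.ennreal_ofReal
      _ ≤ ∫⁻ ω, (Z ω * ENNReal.ofReal (Real.exp (-pmfExp (μ i ω h) B))) *
            ENNReal.ofReal (Real.exp (pmfExp (μ i ω h) B)) ∂ℙ :=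
          lintegral_mono fun ω => mul_le_mul_right
            (lintegral_exp_sampleLaw_le h _ hG hB hB' hGB) _
      _ = ∫⁻ ω, Z ω ∂ℙ := by
          refine lintegral_congr fun ω => ?_
          rw [mul_assoc, ← ENNReal.ofReal_mul (Real.exp_nonneg _), ← Real.exp_add,
            neg_add_cancel, Real.exp_zero, ENNReal.ofReal_one, mul_one]
  have hset : {ω | ℓ ≤ ∑ i, (G (D ω i h) - pmfExp (μ i ω h) B)} =
      {ω | ENNReal.ofReal (Real.exp ℓ) ≤ ∏ i, Y i ω} := by
    ext ω
    simp only [Set.mem_ofPred_eq, Y]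
    rw [← ENNReal.ofReal_prod_of_nonneg fun i _ => Real.exp_nonneg _, ← Real.exp_sum,
      ENNReal.ofReal_le_ofReal_iff (Real.exp_nonneg _), Real.exp_le_exp]
  rw [hset]
  refine (meas_ge_le_lintegral_div hYm.aemeasurable
    (ENNReal.ofReal_pos.2 (Real.exp_pos ℓ)).ne' ENNReal.ofReal_ne_top).trans ?_
  rw [Real.exp_neg, ENNReal.ofReal_inv_of_pos (Real.exp_pos ℓ), ← one_div]
  exact ENNReal.div_le_div_right hprod _

end IsAdaptiveSample

end EpisodicMDP

/-! ### Deviation of weighted TD errors from weighted Bellman errors -/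

namespace EpisodicMDP

variable {X A : Type*} [Countable X] [Countable A]
  [MeasurableSpace X] [MeasurableSingletonClass X]
  [MeasurableSpace A] [MeasurableSingletonClass A] {H : ℕ} {M : EpisodicMDP X A H}
  {f : Fin H → X → A → ℝ} {π : DetPolicy X A H}

theorem measurable_tdError (f : Fin H → X → A → ℝ) (h : Fin H) :
    Measurable (tdError f h : Sample X A → ℝ) := by
  have h1 : Measurable fun z : Sample X A => f h z.1 z.2.1 :=
    (Measurable.of_discrete (f := fun p : X × A => f h p.1 p.2)).comp
      (measurable_fst.prodMk measurable_snd.fst)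
  have h2 : Measurable fun z : Sample X A => nextMax f h z.2.2.2 :=
    (Measurable.of_discrete (f := nextMax f h)).comp measurable_snd.snd.snd
  exact (h1.sub measurable_snd.snd.fst).sub h2

omit [Countable X] [MeasurableSingletonClass X] [Countable A] [MeasurableSpace A]
  [MeasurableSingletonClass A] in
theorem ae_abs_tdError_le (hf : ∀ h x a, f h x a ∈ Set.Icc (0 : ℝ) 1)
    (hπ : ∀ h x a, f h x a ≤ f h x (π h x)) (h : Fin H) (p : X × A) :
    ∀ᵐ q ∂(M.outcomeLaw h p), |tdError f h (p.1, p.2, q.1, q.2)| ≤ 2 := by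
  filter_upwards [Measure.quasiMeasurePreserving_fst.ae (M.R_mem h p.1 p.2)] with q hq
  have h1 := hf h p.1 p.2
  have h2 := nextMax_mem hf hπ h q.2
  rw [tdError, abs_le]
  constructor <;> linarith [h1.1, h1.2, h2.1, h2.2, hq.1, hq.2]

theorem integrable_tdError (hf : ∀ h x a, f h x a ∈ Set.Icc (0 : ℝ) 1)
    (hπ : ∀ h x a, f h x a ≤ f h x (π h x)) (h : Fin H) (p : X × A) :
    Integrable (fun q : ℝ × X => tdError f h (p.1, p.2, q.1, q.2)) (M.outcomeLaw h p) :=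
  Integrable.of_bound
    ((measurable_tdError f h).comp (by fun_prop :
      Measurable fun q : ℝ × X => ((p.1, p.2, q.1, q.2) : Sample X A))).aestronglyMeasurable 2
    (ae_abs_tdError_le hf hπ h p)

omit [Countable A] [MeasurableSpace A] [MeasurableSingletonClass A] in
theorem integral_tdError (hf : ∀ h x a, f h x a ∈ Set.Icc (0 : ℝ) 1)
    (hπ : ∀ h x a, f h x a ≤ f h x (π h x)) (h : Fin H) (p : X × A) :
    ∫ q, tdError f h (p.1, p.2, q.1, q.2) ∂(M.outcomeLaw h p) = M.bellmanErr f h p := by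
  have := M.R_prob h p.1 p.2
  have hn : Integrable (nextMax f h) (M.P h p.1 p.2).toMeasure :=
    Integrable.of_bound Measurable.of_discrete.aestronglyMeasurable 1
      (Filter.Eventually.of_forall fun x => abs_nextMax_le hf hπ h x)
  have h1 : Integrable (fun q : ℝ × X => q.1)
      ((M.R h p.1 p.2).prod (M.P h p.1 p.2).toMeasure) :=
    (M.integrable_reward h p.1 p.2).comp_fst _
  have h2 : Integrable (fun q : ℝ × X => f h p.1 p.2 - q.1)
      ((M.R h p.1 p.2).prod (M.P h p.1 p.2).toMeasure) := (integrable_const _).sub h1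
  simp only [tdError, outcomeLaw]
  rw [integral_sub h2 (hn.comp_snd _), integral_sub (integrable_const _) h1, integral_fun_fst (fun r : ℝ => r),
    integral_fun_snd (nextMax f h), PMF.integral_eq_tsum _ _ hn]
  simp [bellmanErr, meanReward, pmfExp]

/-- Since |TD error| ≤ 2, |s| ≤ 1, |t| ≤ 8 and y² ≤ y, the exponent u satisfies |u| ≤ (10/13)y ≤ 1.
Then exp u ≤ 1 + u + u², and u² ≤ (100/169)y². The scale 13 makes the resulting 100/13 smaller than
8, as the regularizer requires. -/
theorem lintegral_exp_tdError_le (hf : ∀ h x a, f h x a ∈ Set.Icc (0 : ℝ) 1)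
    (hπ : ∀ h x a, f h x a ≤ f h x (π h x)) (h : Fin H) (p : X × A) {s t y : ℝ}
    (hs : |s| ≤ 1) (ht : |t| ≤ 8) (hy : y ∈ Set.Icc (0 : ℝ) 1) :
    ∫⁻ q, ENNReal.ofReal (Real.exp ((s * y * tdError f h (p.1, p.2, q.1, q.2) + t * y ^ 2) / 13))
        ∂(M.outcomeLaw h p) ≤
      ENNReal.ofReal (1 + ((s * y * M.bellmanErr f h p + t * y ^ 2) / 13 + 100 / 169 * y ^ 2)) := by
  have hg := integrable_tdError (M := M) hf hπ h p
  have hu : Integrable (fun q : ℝ × X =>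
      (s * y * tdError f h (p.1, p.2, q.1, q.2) + t * y ^ 2) / 13) (M.outcomeLaw h p) :=
    ((hg.const_mul _).add (integrable_const _)).div_const _
  have hu' : Integrable (fun q : ℝ × X => (s * y * tdError f h (p.1, p.2, q.1, q.2) +
      t * y ^ 2) / 13 + 100 / 169 * y ^ 2) (M.outcomeLaw h p) := hu.add (integrable_const _)
  have hint : Integrable (fun q : ℝ × X => 1 + ((s * y * tdError f h (p.1, p.2, q.1, q.2) +
      t * y ^ 2) / 13 + 100 / 169 * y ^ 2)) (M.outcomeLaw h p) :=
    (integrable_const _).add hu'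
  have hle : ∀ᵐ q ∂(M.outcomeLaw h p),
      Real.exp ((s * y * tdError f h (p.1, p.2, q.1, q.2) + t * y ^ 2) / 13) ≤
        1 + ((s * y * tdError f h (p.1, p.2, q.1, q.2) + t * y ^ 2) / 13 +
          100 / 169 * y ^ 2) := by
    filter_upwards [ae_abs_tdError_le hf hπ h p] with q hq
    set g := tdError f h (p.1, p.2, q.1, q.2)
    have h1 : |s * y * g| ≤ 1 * y * 2 := by
      rw [abs_mul, abs_mul, abs_of_nonneg hy.1]
      exact mul_le_mul (mul_le_mul_of_nonneg_right hs hy.1) hq (abs_nonneg _)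
        (mul_nonneg zero_le_one hy.1)
    have h2 : |t * y ^ 2| ≤ 8 * y := by
      rw [abs_mul, abs_of_nonneg (sq_nonneg y)]
      exact mul_le_mul ht (by nlinarith [hy.1, hy.2]) (sq_nonneg y) (by norm_num)
    have h3 : |(s * y * g + t * y ^ 2) / 13| ≤ 10 / 13 * y := by
      rw [abs_div, abs_of_pos (by norm_num : (0 : ℝ) < 13), div_le_iff₀ (by norm_num)]
      linarith [abs_add_le (s * y * g) (t * y ^ 2)]
    have h4 := (abs_le.1 (Real.abs_exp_sub_one_sub_id_le
      (h3.trans (by linarith [hy.2] : 10 / 13 * y ≤ 1)))).2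
    have h5 := pow_le_pow_left₀ (abs_nonneg _) h3 2
    rw [sq_abs] at h5
    linarith
  refine (lintegral_mono_ae (hle.mono fun q hq => ENNReal.ofReal_le_ofReal hq)).trans ?_
  rw [← ofReal_integral_eq_lintegral_ofReal hint
    (hle.mono fun q hq => (Real.exp_nonneg _).trans hq),
    integral_add (integrable_const _) hu',
    integral_add hu (integrable_const _), integral_div,
    integral_add (hg.const_mul _) (integrable_const _), integral_const_mul,
    integral_tdError hf hπ]
  simp

/-- The empirical estimate of a weighted Bellman error, with a penalty or bonus of size `t / c`
on the squared weights, exceeds its population counterpart by at most `ε`. -/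
def DeviationLE {n : ℕ} (M : EpisodicMDP X A H) (ν : DataDist X A H) (D : Dataset X A H n)
    (c ε : ℝ) (f : Fin H → X → A → ℝ) (w : Fin H → X → A → ℝ≥0∞) (h : Fin H) (s t : ℝ) : Prop :=
  s * empExp D h (fun z => clip c (w h z.1 z.2.1 : EReal) * tdError f h z) +
      t / c * empExp D h (fun z => clip c (w h z.1 z.2.1 : EReal) ^ 2) ≤
    s * pmfExp (ν h) (fun p => clip c (w h p.1 p.2 : EReal) * M.bellmanErr f h p) +
      (t + 100 / 13) / c * pmfExp (ν h) (fun p => clip c (w h p.1 p.2 : EReal) ^ 2) + ε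

/-- The tail bound is applied to weights normalized to y = v/c in [0, 1]. Undoing the scale
multiplies by 13c/n = 13γ, which turns ℓ into 13γℓ and 100/169 into (100/13)/c. -/
theorem IsAdaptiveSample.measure_not_deviationLE_le {Ω : Type uΩ} [mΩ : MeasurableSpace Ω]
    {ℙ : Measure Ω} [IsProbabilityMeasure ℙ] {ℱ : Filtration ℕ mΩ} {n : ℕ} [NeZero n]
    {μ : Fin n → Ω → DataDist X A H} {D : Ω → Dataset X A H n}
    (hD : M.IsAdaptiveSample ℙ ℱ μ D) (hf : ∀ h x a, f h x a ∈ Set.Icc (0 : ℝ) 1)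
    (hπ : ∀ h x a, f h x a ≤ f h x (π h x)) (w : Fin H → X → A → ℝ≥0∞) (h : Fin H) {s t : ℝ}
    (hs : |s| ≤ 1) (ht : |t| ≤ 8) {γ : ℝ} (hγ : 0 < γ) (ℓ : ℝ) :
    ℙ {ω | ¬ M.DeviationLE (mixture fun i => μ i ω) (D ω) (γ * n) (13 * γ * ℓ) f w h s t} ≤
      ENNReal.ofReal (Real.exp (-ℓ)) := by
  have hn : (0 : ℝ) < n := Nat.cast_pos.2 (Nat.pos_of_ne_zero (NeZero.ne n))
  have hc : 0 < γ * n := mul_pos hγ hn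
  set c := γ * n with hcdef
  set v : X × A → ℝ := fun p => clip c (w h p.1 p.2 : EReal)
  set y : X × A → ℝ := fun p => v p / c
  have hv : ∀ p, |v p| ≤ c := fun p => abs_clip_coe_le hc.le _
  have hy : ∀ p, y p ∈ Set.Icc (0 : ℝ) 1 := fun p =>
    ⟨div_nonneg (clip_coe_nonneg hc.le _) hc.le, (div_le_one hc).2 (clip_coe_le hc.le _)⟩
  set G : Sample X A → ℝ := fun z =>
    (s * y (z.1, z.2.1) * tdError f h z + t * y (z.1, z.2.1) ^ 2) / 13 with hG
  set B : X × A → ℝ := fun p =>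
    (s * y p * M.bellmanErr f h p + t * y p ^ 2) / 13 + 100 / 169 * y p ^ 2 with hB
  have hGm : Measurable G := by
    have h1 : Measurable fun z : Sample X A => y (z.1, z.2.1) :=
      (Measurable.of_discrete (f := y)).comp (measurable_fst.prodMk measurable_snd.fst)
    exact ((((h1.const_mul s).mul (measurable_tdError f h)).add
      ((h1.pow_const 2).const_mul t)).div_const 13)
  have hBd : ∀ p, -1 ≤ B p ∧ B p ≤ 2 := fun p => by
    have h0 := hy p
    have h1 : |s * y p * M.bellmanErr f h p| ≤ 1 * 1 * 2 := by
      rw [abs_mul, abs_mul, abs_of_nonneg h0.1]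
      exact mul_le_mul (mul_le_mul hs h0.2 h0.1 zero_le_one) (M.abs_bellmanErr_le hf hπ h p)
        (abs_nonneg _) (by norm_num)
    have h3 : y p ^ 2 ≤ 1 := pow_le_one₀ h0.1 h0.2
    have h2 : |t * y p ^ 2| ≤ 8 * 1 := by
      rw [abs_mul, abs_of_nonneg (sq_nonneg (y p))]
      exact mul_le_mul ht h3 (sq_nonneg _) (by norm_num)
    rw [abs_le] at h1 h2
    simp only [hB]
    constructor <;> linarith [sq_nonneg (y p), h1.1, h1.2, h2.1, h2.2]
  refine (measure_mono fun ω hω => ?_).trans (hD.measure_le_exp_neg h hGm (B := B) (C := 2)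
    (fun p => abs_le.2 ⟨by linarith [(hBd p).1], (hBd p).2⟩) (fun p => (hBd p).1)
    (fun p => lintegral_exp_tdError_le hf hπ h p hs ht (hy p)) ℓ)
  by_contra hlt
  refine hω ?_
  simp only [Set.mem_ofPred_eq, not_le, Finset.sum_sub_distrib] at hlt
  have hvE : ∀ p, |v p * M.bellmanErr f h p| ≤ c * 2 := fun p => by
    rw [abs_mul]
    exact mul_le_mul (hv p) (M.abs_bellmanErr_le hf hπ h p) (abs_nonneg _) hc.le
  have hv2 : ∀ p, |v p ^ 2| ≤ c ^ 2 := fun p => by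
    rw [abs_pow]
    exact pow_le_pow_left₀ (abs_nonneg _) (hv p) 2
  -- The compensators of the n adaptive rounds add up to n times one expectation under the mixture,
  -- so only the mixture enters the bound.
  have hmix : ∑ i, pmfExp (μ i ω h) B =
      n / (13 * c) * (s * pmfExp (mixture (fun i => μ i ω) h) (fun p => v p * M.bellmanErr f h p) +
        (t + 100 / 13) / c * pmfExp (mixture (fun i => μ i ω) h) fun p => v p ^ 2) := by
    have h1 : B = fun p => (s / (13 * c)) * (v p * M.bellmanErr f h p) +
        ((t + 100 / 13) / (13 * c ^ 2)) * v p ^ 2 := by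
      funext p
      simp only [hB, y]
      field_simp
      ring
    have h2 : pmfExp (mixture (fun i => μ i ω) h) B =
        (s / (13 * c)) * pmfExp (mixture (fun i => μ i ω) h) (fun p => v p * M.bellmanErr f h p) +
        ((t + 100 / 13) / (13 * c ^ 2)) *
          pmfExp (mixture (fun i => μ i ω) h) fun p => v p ^ 2 := by
      rw [h1, ← pmfExp_const_mul, ← pmfExp_const_mul]
      refine pmfExp_add _ (C := |s / (13 * c)| * (c * 2))
        (D := |(t + 100 / 13) / (13 * c ^ 2)| * c ^ 2) ?_ ?_
      · intro p
        rw [abs_mul]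
        exact mul_le_mul_of_nonneg_left (hvE p) (abs_nonneg _)
      · intro p
        rw [abs_mul]
        exact mul_le_mul_of_nonneg_left (hv2 p) (abs_nonneg _)
    rw [pmfExp_mixture (fun i => μ i ω) h (C := 2)
      (fun p => abs_le.2 ⟨by linarith [(hBd p).1], (hBd p).2⟩)] at h2
    have h3 : ∑ i, pmfExp (μ i ω h) B = n * (1 / n * ∑ i, pmfExp (μ i ω h) B) := by
      field_simp
    rw [h3, h2]
    field_simp
  have hemp : ∑ i, G (D ω i h) =
      n / (13 * c) * (s * empExp (D ω) h (fun z => v (z.1, z.2.1) * tdError f h z) +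
        t / c * empExp (D ω) h fun z => v (z.1, z.2.1) ^ 2) := by
    have h1 : ∀ z, G z = (s / (13 * c)) * (v (z.1, z.2.1) * tdError f h z) +
        (t / (13 * c ^ 2)) * v (z.1, z.2.1) ^ 2 := by
      intro z
      simp only [hG, y]
      field_simp
    simp only [h1, Finset.sum_add_distrib, ← Finset.mul_sum, empExp]
    field_simp
  rw [hmix, hemp] at hlt
  have hk : (0 : ℝ) < n / (13 * c) := by positivity
  have hℓ : ℓ = n / (13 * c) * (13 * γ * ℓ) := by
    rw [hcdef]
    field_simp
  rw [hℓ, ← mul_sub, mul_lt_mul_iff_right₀ hk] at hlt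
  exact (sub_lt_iff_lt_add'.1 hlt).le

end EpisodicMDP

/-! ### The objective of MABO.CR -/

section Objective

variable {X A : Type*} {H n : ℕ} {W : Finset (Fin H → X → A → ℝ≥0∞)}

theorem signedClass_finite (W : Finset (Fin H → X → A → ℝ≥0∞)) : (signedClass W).Finite :=
  W.finite_toSet.image _

theorem augmentedClass_finite (W : Finset (Fin H → X → A → ℝ≥0∞)) : (augmentedClass W).Finite :=
  ((signedClass_finite W).union ((signedClass_finite W).image _)).union
    (Set.finite_iUnion fun _ => ((signedClass_finite W).image _).union
      (((signedClass_finite W).image _).image _))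

theorem restrictLayer_mem_augmentedClass {w : Fin H → X → A → ℝ≥0∞} (hw : w ∈ W) (h : Fin H) :
    restrictLayer h (fun h x a => (w h x a : EReal)) ∈ augmentedClass W :=
  Or.inr (Set.mem_iUnion.2 ⟨h, Or.inl ⟨_, ⟨w, hw, rfl⟩, rfl⟩⟩)

/-- This reduces a bound over the augmented class to one layer and one member of `W`: each layer is
plus or minus such a member, or zero. -/
theorem mem_augmentedClass_layer {w : Fin H → X → A → EReal} (hw : w ∈ augmentedClass W)
    (h : Fin H) :
    (∃ w' ∈ W, (∀ x a, w h x a = (w' h x a : EReal)) ∨ ∀ x a, w h x a = -(w' h x a : EReal)) ∨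
      ∀ x a, w h x a = 0 := by
  rcases hw with (⟨w', hw', rfl⟩ | ⟨_, ⟨w', hw', rfl⟩, rfl⟩) | hw
  · exact Or.inl ⟨w', hw', Or.inl fun x a => rfl⟩
  · exact Or.inl ⟨w', hw', Or.inr fun x a => rfl⟩
  · obtain ⟨k, ⟨_, ⟨w', hw', rfl⟩, rfl⟩ | ⟨_, ⟨_, ⟨w', hw', rfl⟩, rfl⟩, rfl⟩⟩ := Set.mem_iUnion.1 hw
    · by_cases hk : k = h
      · subst hk
        exact Or.inl ⟨w', hw', Or.inl fun x a => by simp [restrictLayer]⟩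
      · exact Or.inr fun x a => by simp [restrictLayer, hk]
    · by_cases hk : k = h
      · subst hk
        exact Or.inl ⟨w', hw', Or.inr fun x a => by simp [restrictLayer]⟩
      · exact Or.inr fun x a => by simp [restrictLayer, hk]

/-- Layer terms may be negative because of the regularizer, so a bound on their sum says nothing
about one of them; single-layer weights isolate it. -/
theorem maboObjective_restrictLayer {γ : ℝ} (hγ : 0 ≤ γ) (D : Dataset X A H n)
    (f : Fin H → X → A → ℝ) (h : Fin H) (w : Fin H → X → A → EReal) :
    maboObjective γ D f (restrictLayer h w) =
      |empExp D h fun z => clip (γ * n) (w h z.1 z.2.1) * tdError f h z| -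
        8 / (γ * n) * empExp D h fun z => clip (γ * n) (w h z.1 z.2.1) ^ 2 := by
  have hc : 0 ≤ γ * n := mul_nonneg hγ n.cast_nonneg
  rw [maboObjective, Finset.sum_eq_single h]
  · simp [restrictLayer]
  · intro k _ hk
    simp [restrictLayer, hk.symm, clip_zero hc, empExp]
  · simp

theorem maboObjective_le_of_layer_le {γ : ℝ} (hγ : 0 ≤ γ) (D : Dataset X A H n)
    (f : Fin H → X → A → ℝ) {ε : ℝ} (hε : 0 ≤ ε)
    (hW : ∀ w ∈ W, ∀ h,
      |empExp D h fun z => clip (γ * n) (w h z.1 z.2.1 : EReal) * tdError f h z| -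
        8 / (γ * n) * empExp D h (fun z => clip (γ * n) (w h z.1 z.2.1 : EReal) ^ 2) ≤ ε)
    {w : Fin H → X → A → EReal} (hw : w ∈ augmentedClass W) :
    maboObjective γ D f w ≤ H * ε := by
  have hc : 0 ≤ γ * n := mul_nonneg hγ n.cast_nonneg
  calc maboObjective γ D f w ≤ ∑ _h : Fin H, ε := Finset.sum_le_sum fun h _ => ?_
    _ = H * ε := by simp
  rcases mem_augmentedClass_layer hw h with ⟨w', hw', h1 | h1⟩ | h1
  · simp only [h1]
    exact hW w' hw' h
  · have h2 : (empExp D h fun z => -(clip (γ * n) (w' h z.1 z.2.1 : EReal) * tdError f h z)) =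
        -empExp D h fun z => clip (γ * n) (w' h z.1 z.2.1 : EReal) * tdError f h z := by
      simp [empExp]
    simp only [h1, clip_neg hc, neg_mul, neg_sq, h2, abs_neg]
    exact hW w' hw' h
  · simpa [h1, clip_zero hc, empExp] using hε

end Objective

/-! ### From deviation bounds to suboptimality -/

namespace EpisodicMDP

variable {X A : Type*} {H n : ℕ} {M : EpisodicMDP X A H} {ν : DataDist X A H}
  {D : Dataset X A H n} {f : Fin H → X → A → ℝ}

/-- This is used for f = Q⋆. With t = -8 the population second moment has coefficient (-8 +
100/13)/c < 0 and can be dropped. -/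
theorem abs_empExp_le_of_deviationLE {c ε : ℝ} {w : Fin H → X → A → ℝ≥0∞} {h : Fin H}
    (hc : 0 < c) (h0 : ∀ p, M.bellmanErr f h p = 0)
    (hpos : M.DeviationLE ν D c ε f w h 1 (-8)) (hneg : M.DeviationLE ν D c ε f w h (-1) (-8)) :
    |empExp D h fun z => clip c (w h z.1 z.2.1 : EReal) * tdError f h z| -
      8 / c * empExp D h (fun z => clip c (w h z.1 z.2.1 : EReal) ^ 2) ≤ ε := by
  have h1 : 0 ≤ pmfExp (ν h) fun p => clip c (w h p.1 p.2 : EReal) ^ 2 :=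
    pmfExp_nonneg _ fun p => sq_nonneg _
  have h2 : (-8 + 100 / 13) / c * pmfExp (ν h) (fun p => clip c (w h p.1 p.2 : EReal) ^ 2) ≤ 0 :=
    mul_nonpos_of_nonpos_of_nonneg (div_nonpos_of_nonpos_of_nonneg (by norm_num) hc.le) h1
  simp only [DeviationLE, h0, mul_zero, pmfExp_const, neg_div, neg_mul] at hpos hneg
  rw [sub_le_iff_le_add, abs_le]
  constructor <;> linarith

/-- This is used for the minimizer. With t = 8 the regularized empirical term appears with the right
sign, and 8 + 100/13 ≤ 16. -/
theorem abs_pmfExp_bellmanErr_le_of_deviationLE {c ε : ℝ} {w : Fin H → X → A → ℝ≥0∞} {h : Fin H}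
    (hc : 0 < c)
    (hpos : M.DeviationLE ν D c ε f w h 1 8) (hneg : M.DeviationLE ν D c ε f w h (-1) 8) :
    |pmfExp (ν h) fun p => clip c (w h p.1 p.2 : EReal) * M.bellmanErr f h p| ≤
      |empExp D h fun z => clip c (w h z.1 z.2.1 : EReal) * tdError f h z| -
        8 / c * empExp D h (fun z => clip c (w h z.1 z.2.1 : EReal) ^ 2) +
        16 / c * pmfExp (ν h) (fun p => clip c (w h p.1 p.2 : EReal) ^ 2) + ε := by
  have h1 : 0 ≤ pmfExp (ν h) fun p => clip c (w h p.1 p.2 : EReal) ^ 2 :=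
    pmfExp_nonneg _ fun p => sq_nonneg _
  have h2 : (8 + 100 / 13) / c * pmfExp (ν h) (fun p => clip c (w h p.1 p.2 : EReal) ^ 2) ≤
      16 / c * pmfExp (ν h) (fun p => clip c (w h p.1 p.2 : EReal) ^ 2) :=
    mul_le_mul_of_nonneg_right (div_le_div_of_nonneg_right (by norm_num) hc.le) h1
  have h3 := abs_le.1 (le_refl
    |empExp D h fun z => clip c (w h z.1 z.2.1 : EReal) * tdError f h z|)
  rw [DeviationLE] at hpos hneg
  rw [abs_le]
  constructor <;> linarith [h3.1, h3.2]

theorem clippedConc_eq {h : Fin H} {π : RandPolicy X A H} {c : ℝ} (hc : 0 ≤ c) :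
    clippedConc M h π ν c =
      pmfExp (M.occ π h) fun p => clip c (densityRatio (M.occ π h) (ν h) p.1 p.2 : EReal) :=
  tsum_congr fun p => by rw [abs_of_nonneg (clip_coe_nonneg hc _)]

variable {F : Finset (Fin H → X → A → ℝ)} {W : Finset (Fin H → X → A → ℝ≥0∞)}
  {greedy : (Fin H → X → A → ℝ) → DetPolicy X A H} {πstar : DetPolicy X A H} {γ ε : ℝ}

/-- On the event that all deviation bounds hold, the Bellman errors of a minimizer of the
objective are small under the occupancy measures of the policy class. -/
theorem abs_pmfExp_occ_bellmanErr_le [NeZero n]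
    (hF : ∀ f ∈ F, ∀ h x a, f h x a ∈ Set.Icc (0 : ℝ) 1)
    (hgreedy : ∀ f ∈ F, ∀ h x a, f h x a ≤ f h x (greedy f h x))
    (hopt : M.IsOptimal πstar) (hγ : 0 < γ) (hε : 0 ≤ ε)
    (hcond : MaboCond M πstar F W (inducedPolicies F greedy) ν)
    (hdev : ∀ f ∈ F, ∀ w ∈ W, ∀ h, ∀ s ∈ ({1, -1} : Finset ℝ), ∀ t ∈ ({8, -8} : Finset ℝ),
      M.DeviationLE ν D (γ * n) ε f w h s t)
    (hf : IsMaboMinimizer F (augmentedClass W) γ D f) {π : DetPolicy X A H}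
    (hπ : π ∈ inducedPolicies F greedy) (h : Fin H) :
    |pmfExp (M.occ π.toRand h) (M.bellmanErr f h)| ≤
      (H + 1) * ε + 18 / (γ * n) * clippedConc M h π.toRand ν (γ * n) := by
  have hn : (0 : ℝ) < n := Nat.cast_pos.2 (Nat.pos_of_ne_zero (NeZero.ne n))
  have hc : 0 < γ * n := mul_pos hγ hn
  obtain ⟨w, hw, hwh⟩ := hcond.2 π hπ h
  -- The single-layer weight competes in the maximum for f, which is at most the maximum for Q⋆, and
  -- that is at most Hε. Finiteness of the class makes the real `sSup` a genuine maximum.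
  have hmax : maboObjective γ D f (restrictLayer h fun h x a => (w h x a : EReal)) ≤ H * ε := by
    have hmem := restrictLayer_mem_augmentedClass hw h
    refine (le_csSup ((augmentedClass_finite W).image _).bddAbove
      (Set.mem_image_of_mem _ hmem)).trans ((hf.2 _ hcond.1).trans
      (csSup_le (Set.Nonempty.image _ ⟨_, hmem⟩) ?_))
    rintro _ ⟨w', hw', rfl⟩
    exact maboObjective_le_of_layer_le hγ.le D _ hε (fun w hw h =>
      abs_empExp_le_of_deviationLE hc (hopt.bellmanErr_Q h)
        (hdev _ hcond.1 w hw h 1 (by simp) (-8) (by simp))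
        (hdev _ hcond.1 w hw h (-1) (by simp) (-8) (by simp))) hw'
  rw [maboObjective_restrictLayer hγ.le] at hmax
  have h1 := abs_pmfExp_bellmanErr_le_of_deviationLE hc
    (hdev f hf.1 w hw h 1 (by simp) 8 (by simp)) (hdev f hf.1 w hw h (-1) (by simp) 8 (by simp))
  simp only [hwh] at h1 hmax
  have h2 := abs_pmfExp_sub_clip_le (M.occ π.toRand h) (ν h) hc
    (M.abs_bellmanErr_le (hF f hf.1) (hgreedy f hf.1) h)
  have h3 := mul_le_mul_of_nonneg_left (pmfExp_clip_sq_le (M.occ π.toRand h) (ν h) hc.le)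
    (by positivity : 0 ≤ 16 / (γ * n))
  rw [← clippedConc_eq hc.le] at h2 h3
  have h4 := abs_sub_abs_le_abs_sub (pmfExp (M.occ π.toRand h) (M.bellmanErr f h))
    (pmfExp (ν h) fun p => clip (γ * n) (densityRatio (M.occ π.toRand h) (ν h) p.1 p.2 : EReal) *
      M.bellmanErr f h p)
  -- 18 is 16 from the second moment plus 2 from the clipping bias, the Bellman error being bounded
  -- by 2.
  have h5 : 18 / (γ * n) * clippedConc M h π.toRand ν (γ * n) =
      16 / (γ * n) * clippedConc M h π.toRand ν (γ * n) +
        2 / (γ * n) * clippedConc M h π.toRand ν (γ * n) := by ring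
  linarith

theorem J_sub_J_greedy_le_of_deviationLE [NeZero n]
    (hF : ∀ f ∈ F, ∀ h x a, f h x a ∈ Set.Icc (0 : ℝ) 1)
    (hgreedy : ∀ f ∈ F, ∀ h x a, f h x a ≤ f h x (greedy f h x))
    (hopt : M.IsOptimal πstar) (hmem : πstar ∈ inducedPolicies F greedy)
    (hγ : 0 < γ) (hε : 0 ≤ ε)
    (hcond : MaboCond M πstar F W (inducedPolicies F greedy) ν)
    (hdev : ∀ f ∈ F, ∀ w ∈ W, ∀ h, ∀ s ∈ ({1, -1} : Finset ℝ), ∀ t ∈ ({8, -8} : Finset ℝ),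
      M.DeviationLE ν D (γ * n) ε f w h s t)
    (hf : IsMaboMinimizer F (augmentedClass W) γ D f) :
    M.J πstar.toRand - M.J (greedy f).toRand ≤
      (∑ h, 18 / (γ * n) * (clippedConc M h πstar.toRand ν (γ * n) +
        clippedConc M h (greedy f).toRand ν (γ * n))) + 2 * H * (H + 1) * ε := by
  have hb := fun {π : DetPolicy X A H} (hπ : π ∈ inducedPolicies F greedy) (h : Fin H) =>
    abs_pmfExp_occ_bellmanErr_le hF hgreedy hopt hγ hε hcond hdev hf hπ h
  calc M.J πstar.toRand - M.J (greedy f).toRand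
      ≤ ∑ h, (pmfExp (M.occ (greedy f).toRand h) (M.bellmanErr f h) -
          pmfExp (M.occ πstar.toRand h) (M.bellmanErr f h)) :=
        M.J_sub_J_greedy_le (hF f hf.1) (hgreedy f hf.1) πstar
    _ ≤ ∑ h, (18 / (γ * n) * (clippedConc M h πstar.toRand ν (γ * n) +
          clippedConc M h (greedy f).toRand ν (γ * n)) + 2 * (H + 1) * ε) := by
        refine Finset.sum_le_sum fun h _ => ?_
        have h1 := (abs_le.1 (hb ⟨f, hf.1, rfl⟩ h)).2
        have h2 := (abs_le.1 (hb hmem h)).1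
        linarith
    _ = _ := by
        rw [Finset.sum_add_distrib, Finset.sum_const, Finset.card_univ, Fintype.card_fin,
          nsmul_eq_mul]
        ring

end EpisodicMDP

/-! ### Union bound and conclusion -/

theorem policyExp_pure {X A : Type*} {H : ℕ} (π : DetPolicy X A H) (g : DetPolicy X A H → ℝ) :
    policyExp (PMF.pure π) g = g π :=
  pmfExp_pure π g

/-- The deviation bounds hold simultaneously with probability at least `1 - δ`. -/
theorem EpisodicMDP.IsAdaptiveSample.measure_exists_not_deviationLE_le {X A : Type*}
    [Countable X] [Countable A]
    [MeasurableSpace X] [MeasurableSingletonClass X]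
    [MeasurableSpace A] [MeasurableSingletonClass A] {H n : ℕ} [NeZero n]
    {M : EpisodicMDP X A H} {Ω : Type uΩ} [mΩ : MeasurableSpace Ω]
    {ℙ : Measure Ω} [IsProbabilityMeasure ℙ] {ℱ : Filtration ℕ mΩ}
    {μ : Fin n → Ω → DataDist X A H} {D : Ω → Dataset X A H n}
    (hD : M.IsAdaptiveSample ℙ ℱ μ D) {F : Finset (Fin H → X → A → ℝ)}
    (hF : ∀ f ∈ F, ∀ h x a, f h x a ∈ Set.Icc (0 : ℝ) 1)
    {greedy : (Fin H → X → A → ℝ) → DetPolicy X A H}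
    (hgreedy : ∀ f ∈ F, ∀ h x a, f h x a ≤ f h x (greedy f h x))
    (W : Finset (Fin H → X → A → ℝ≥0∞)) {γ : ℝ} (hγ : 0 < γ) (ℓ : ℝ) :
    ℙ {ω | ¬ ∀ f ∈ F, ∀ w ∈ W, ∀ h, ∀ s ∈ ({1, -1} : Finset ℝ), ∀ t ∈ ({8, -8} : Finset ℝ),
      M.DeviationLE (mixture fun i => μ i ω) (D ω) (γ * n) (13 * γ * ℓ) f w h s t} ≤
      ENNReal.ofReal (F.card * W.card * H * 4 * Real.exp (-ℓ)) := by
  classical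
  -- The two signs and the two values of t give the factor 4.
  let S := F ×ˢ W ×ˢ (Finset.univ : Finset (Fin H)) ×ˢ ({1, -1} : Finset ℝ) ×ˢ
    ({8, -8} : Finset ℝ)
  have hS : (S.card : ℝ) = F.card * W.card * H * 4 := by
    have h1 : ({1, -1} : Finset ℝ).card = 2 := Finset.card_pair (by norm_num)
    have h2 : ({8, -8} : Finset ℝ).card = 2 := Finset.card_pair (by norm_num)
    simp only [S, Finset.card_product, h1, h2, Finset.card_univ, Fintype.card_fin]
    push_cast
    ring
  calc _ ≤ ℙ (⋃ q ∈ S, {ω | ¬ M.DeviationLE (mixture fun i => μ i ω) (D ω) (γ * n) (13 * γ * ℓ)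
        q.1 q.2.1 q.2.2.1 q.2.2.2.1 q.2.2.2.2}) := by
        refine measure_mono fun ω hω => ?_
        simp only [Set.mem_ofPred_eq] at hω
        push Not at hω
        obtain ⟨f, hf, w, hw, h, s, hs, t, ht, hnot⟩ := hω
        refine Set.mem_biUnion (x := (f, w, h, s, t)) ?_ hnot
        simp only [S, Finset.coe_product, Set.mem_prod, Finset.mem_coe, Finset.mem_univ]
        exact ⟨hf, hw, trivial, hs, ht⟩
    _ ≤ ∑ q ∈ S, ENNReal.ofReal (Real.exp (-ℓ)) := by
        refine (measure_biUnion_finset_le _ _).trans (Finset.sum_le_sum ?_)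
        rintro ⟨f, w, h, s, t⟩ hq
        simp only [S, Finset.mem_product, Finset.mem_insert, Finset.mem_singleton] at hq
        obtain ⟨hf, hw, -, hs, ht⟩ := hq
        refine hD.measure_not_deviationLE_le (hF f hf) (hgreedy f hf) w h ?_ ?_ hγ ℓ
        · rcases hs with rfl | rfl <;> simp
        · rcases ht with rfl | rfl <;> simp
    _ = ENNReal.ofReal (F.card * W.card * H * 4 * Real.exp (-ℓ)) := by
        rw [Finset.sum_const, nsmul_eq_mul, ← hS, ENNReal.ofReal_mul (Nat.cast_nonneg _),
          ENNReal.ofReal_natCast]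

theorem mainTheorem4 {X A : Type*} [Countable X] [Countable A]
    [MeasurableSpace X] [MeasurableSingletonClass X]
    [MeasurableSpace A] [MeasurableSingletonClass A] {H : ℕ}
    (M : EpisodicMDP X A H)
    (F : Finset (Fin H → X → A → ℝ)) (hF : ∀ f ∈ F, ∀ h x a, f h x a ∈ Set.Icc (0 : ℝ) 1)
    (W : Finset (Fin H → X → A → ℝ≥0∞))
    (greedy : (Fin H → X → A → ℝ) → DetPolicy X A H)
    (hgreedy : ∀ f ∈ F, ∀ h x a, f h x a ≤ f h x (greedy f h x))
    (πstar : DetPolicy X A H) (hopt : M.IsOptimal πstar)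
    (hmem : πstar ∈ inducedPolicies F greedy)
    (γ : ℝ) (hγ : 0 < γ) (δ : ℝ) (hδ : δ ∈ Set.Ioo (0 : ℝ) 1)
    (algo : OfflineAlg X A H) (halgo : IsMaboCR F (augmentedClass W) γ greedy algo) :
    IsCCBounded.{uΩ} M (inducedPolicies F greedy) πstar algo γ
      (MaboCond M πstar F W (inducedPolicies F greedy))
      (40 / γ)
      (56 * (H : ℝ) ^ 2 * γ *
        Real.log (24 * (F.card : ℝ) * (W.card : ℝ) * (H : ℝ) ^ 2 / δ))
      δ := by
  intro n _
  refine ⟨fun D => ?_, ?_⟩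
  · obtain ⟨f, hf, hp⟩ := halgo n D
    rw [hp, PMF.support_pure, Set.singleton_subset_iff]
    exact ⟨f, hf.1, rfl⟩
  intro Ω mΩ ℙ _ ℱ μ D hD hcond
  have hn : (0 : ℝ) < n := Nat.cast_pos.2 (Nat.pos_of_ne_zero (NeZero.ne n))
  have hc : 0 < γ * n := mul_pos hγ hn
  -- For H = 0 both sides of the bound vanish. A layer is needed below to extract a weight from the
  -- condition.
  rcases Nat.eq_zero_or_pos H with rfl | hH
  · have hJ : ∀ π, M.J π = 0 := fun π => by simp [EpisodicMDP.J, M.V_of_le π le_rfl]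
    simp [hJ, policyExp]
  have hFc : 1 ≤ (F.card : ℝ) := by
    obtain ⟨f, hf, -⟩ := hmem
    exact_mod_cast Finset.card_pos.2 ⟨f, hf⟩
  have hWc : 1 ≤ (W.card : ℝ) := by
    -- An almost sure condition holds at some point of a probability space, so `W` is nonempty and
    -- the logarithm is nonnegative.
    obtain ⟨ω, hω⟩ := hcond.exists
    obtain ⟨w, hw, -⟩ := hω.2 πstar hmem ⟨0, hH⟩
    exact_mod_cast Finset.card_pos.2 ⟨w, hw⟩
  have hHc : 1 ≤ (H : ℝ) := by exact_mod_cast hH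
  set K : ℝ := 24 * (F.card : ℝ) * (W.card : ℝ) * (H : ℝ) ^ 2 with hK
  set ℓ := Real.log (K / δ) with hℓ
  have hK1 : 1 ≤ K := by
    have := one_le_mul_of_one_le_of_one_le (one_le_mul_of_one_le_of_one_le hFc hWc)
      (one_le_pow₀ hHc (n := 2))
    rw [hK]
    linarith
  have hKpos : 0 < K := by linarith
  have hℓ0 : 0 ≤ ℓ := Real.log_nonneg ((one_le_div hδ.1).2 (hδ.2.le.trans hK1))
  have hε : 0 ≤ 13 * γ * ℓ := by positivity
  have hprob : (F.card : ℝ) * W.card * H * 4 * Real.exp (-ℓ) ≤ δ := by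
    rw [hℓ, Real.exp_neg, Real.exp_log (div_pos hKpos hδ.1), inv_div, mul_div_assoc',
      div_le_iff₀ hKpos, mul_comm]
    refine mul_le_mul_of_nonneg_left ?_ hδ.1.le
    have h1 : 0 ≤ (F.card : ℝ) * W.card := by positivity
    have h2 : (H : ℝ) ≤ H ^ 2 := le_self_pow₀ hHc two_ne_zero
    calc (F.card : ℝ) * W.card * H * 4 ≤ F.card * W.card * H ^ 2 * 24 := by gcongr; norm_num
      _ = K := by rw [hK]; ring
  refine (measure_mono_ae ?_).trans ((hD.measure_exists_not_deviationLE_le hF hgreedy W hγ ℓ).trans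
    (ENNReal.ofReal_le_ofReal hprob))
  filter_upwards [hcond] with ω hω hbad hdev
  refine hbad ?_
  obtain ⟨f, hf, hp⟩ := halgo n (D ω)
  simp only [hp, policyExp_pure]
  refine (EpisodicMDP.J_sub_J_greedy_le_of_deviationLE hF hgreedy hopt hmem hγ hε hω hdev
    hf).trans (add_le_add (Finset.sum_le_sum fun h _ => ?_) ?_)
  -- The argument yields 18/γ; the stated 40/γ leaves slack.
  · rw [div_div]
    refine mul_le_mul_of_nonneg_right (div_le_div_of_nonneg_right (by norm_num) hc.le)
      (add_nonneg ?_ ?_) <;>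
    exact tsum_nonneg fun p => mul_nonneg ENNReal.toReal_nonneg (abs_nonneg _)
  -- 2H(H + 1)·13γℓ ≤ 52H²γℓ ≤ 56H²γℓ.
  · have h1 : (H : ℝ) * (H + 1) ≤ 2 * H ^ 2 := by nlinarith
    have h2 : 0 ≤ γ * ℓ := by positivity
    nlinarith [mul_le_mul_of_nonneg_right h1 h2, mul_nonneg (sq_nonneg (H : ℝ)) h2]
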